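/- **Setting.** Let $G:\mathbb{R}^k\to\mathbb{R}^n$, $n\ge 2$, be a generator with $d\ge 1$ layers of width at most $n$: each layer is an affine map (arbitrary weights and bias) followed by a coordinatewise ReLU, except that the output layer may also be purely affine. Put $\mathcal{M}=\mathrm{Range}(G)$, let $x^*\in\mathcal{M}$, let $A\in\mathbb{R}^{m\times n}$ have i.i.d. $N(0,1/m)$ entries, and let $y=|Ax^*|$ (entrywise). For a step size $\eta$, Phase-PGD started at $x_0$ computes, for $t=0,1,2,\dots$, $$p_t=\operatorname{sign}(Ax_t),\qquad w_t=x_t+\eta A^{T}(y\odot p_t-Ax_t),\qquad x_{t+1}=G(z_t),\quad z_t\in\arg\min_{z}\|w_t-G(z)\|,$$ where $\|\cdot\|$ is the Euclidean norm, the minimizer $z_t$ may be chosen arbitrarily, and $\operatorname{sign}(0)$ may be any value in $[-1,1]$. Let $\mathrm{dist}(x,x^*)=\min(\|x-x^*\|,\|x+x^*\|)$. **Theorem (local linear convergence of Phase-PGD).** There are absolute constants $C>0$, $0<\delta_0<1$, $0<\rho<1$, $0<\eta_1<\eta_2$ and $c>0$ such that, for all $k,d,n,m,G,x^*$ as above with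 $m> C\,kd\log n$ and every step size $\eta\in[\eta_1,\eta_2]$, the following holds with probability at least $1-e^{-cm}$ over $A$. For every initialization $x_0\in\mathcal{M}$ with $\mathrm{dist}(x_0,x^*)\le\delta_0\|x^*\|$, and such that $\|x_0-x^*\|\le\|x_0+x^*\|$ or $-x^*\in\mathcal{M}$, all iterates of Phase-PGD satisfy $$\mathrm{dist}(x_{t+1},x^*)\le\rho\,\mathrm{dist}(x_t,x^*)\qquad\text{for all } t\ge 0.$$ (The condition "$\|x_0-x^*\|\le\|x_0+x^*\|$ or $-x^*\in\mathcal{M}$" holds automatically when the output layer has a ReLU, since then $\mathcal{M}$ lies in the nonnegative orthant.) -/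

import Mathlib

open MeasureTheory ProbabilityTheory
open scoped Matrix NNReal

noncomputable section

/-- Coordinatewise rectified linear unit. -/
def relu {q : ℕ} (v : EuclideanSpace ℝ (Fin q)) : EuclideanSpace ℝ (Fin q) :=
  WithLp.toLp 2 fun i => max (v i) 0

/-- The affine map `v ↦ W v + b` with weight matrix `W` and bias `b`. -/
def affineLayer {p q : ℕ} (W : Matrix (Fin q) (Fin p) ℝ) (b : Fin q → ℝ)
    (v : EuclideanSpace ℝ (Fin p)) : EuclideanSpace ℝ (Fin q) :=
  WithLp.toLp 2 (W *ᵥ v.ofLp + b)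

/-- `IsReLUNetwork N d g`: the map `g` is computed by `d` successive layers, each an affine map
followed by a coordinatewise ReLU, and each of width at most `N`. -/
inductive IsReLUNetwork (N : ℕ) {k : ℕ} : ℕ → {q : ℕ} →
    (EuclideanSpace ℝ (Fin k) → EuclideanSpace ℝ (Fin q)) → Prop
  | input : IsReLUNetwork N 0 (fun z : EuclideanSpace ℝ (Fin k) => z)
  | layer {d p q : ℕ} {g : EuclideanSpace ℝ (Fin k) → EuclideanSpace ℝ (Fin p)}
      (hg : IsReLUNetwork N d g) (hq : q ≤ N)
      (W : Matrix (Fin q) (Fin p) ℝ) (b : Fin q → ℝ) :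
      IsReLUNetwork N (d + 1) (fun z => relu (affineLayer W b (g z)))

/-- `G : ℝᵏ → ℝⁿ` is a generator with `d ≥ 1` layers of width at most `n`: `d - 1` hidden ReLU
layers and an output layer, which is either a ReLU layer or a purely affine one. -/
def IsReLUGenerator {k n : ℕ} (d : ℕ)
    (G : EuclideanSpace ℝ (Fin k) → EuclideanSpace ℝ (Fin n)) : Prop :=
  ∃ (d' p : ℕ) (g : EuclideanSpace ℝ (Fin k) → EuclideanSpace ℝ (Fin p))
    (W : Matrix (Fin n) (Fin p) ℝ) (b : Fin n → ℝ),
    d = d' + 1 ∧ IsReLUNetwork n d' g ∧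
      (G = (fun z => relu (affineLayer W b (g z))) ∨ G = fun z => affineLayer W b (g z))

/-- Law of an `m × n` matrix with independent `N(0, 1/m)` entries. -/
def gaussianMatrix (m n : ℕ) : Measure (Fin m → Fin n → ℝ) :=
  Measure.pi fun _ => Measure.pi fun _ => gaussianReal 0 (1 / (m : ℝ≥0))

/-- Distance up to a global sign. -/
def phaseDist {n : ℕ} (x x' : EuclideanSpace ℝ (Fin n)) : ℝ :=
  min ‖x - x'‖ ‖x + x'‖

/-- Phaseless measurements `y = |A x|` (entrywise). -/
def phaselessMeasurements {m n : ℕ} (A : Matrix (Fin m) (Fin n) ℝ)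
    (x : EuclideanSpace ℝ (Fin n)) : Fin m → ℝ :=
  fun i => |(A *ᵥ x.ofLp) i|

/-- `p` is a phase (sign) vector of `v`. At a zero entry of `v` every value in `[-1, 1]` is
admitted, so that the conventions `sign 0 = 0` and `sign 0 = ±1` are all covered. -/
def IsPhase {m : ℕ} (p v : Fin m → ℝ) : Prop :=
  ∀ i, |p i| ≤ 1 ∧ (v i ≠ 0 → p i = Real.sign (v i))

/-- `x = G(argmin_z ‖w - G(z)‖)` for some choice of a minimizer. -/
def IsProjection {k n : ℕ} (G : EuclideanSpace ℝ (Fin k) → EuclideanSpace ℝ (Fin n))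
    (w x : EuclideanSpace ℝ (Fin n)) : Prop :=
  ∃ z, x = G z ∧ ∀ z', ‖w - G z‖ ≤ ‖w - G z'‖

/-- `x 0, …, x T` are iterates of Phase-PGD with input `y, A, G` and step size `η`: in each
iteration `p ← sign(A x)`, `w ← x + η Aᵀ(y ⊙ p - A x)`, `x ← P_G(w)`. -/
def IsPhasePGDRun {k m n : ℕ} (G : EuclideanSpace ℝ (Fin k) → EuclideanSpace ℝ (Fin n))
    (A : Matrix (Fin m) (Fin n) ℝ) (y : Fin m → ℝ) (η : ℝ) (T : ℕ)
    (x : ℕ → EuclideanSpace ℝ (Fin n)) : Prop :=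
  ∀ t < T, ∃ p : Fin m → ℝ, IsPhase p (A *ᵥ (x t).ofLp) ∧
    IsProjection G
      (x t + η • WithLp.toLp 2 (Aᵀ *ᵥ (y * p - A *ᵥ (x t).ofLp))) (x (t + 1))

end

/-! The range of `G` is covered by at most `(n + 1) ^ ((k + 1) * d)` affine pieces of dimension at
most `k` (`exists_affine_pieces_generator`). Hence `x*`, the current iterate and the next one always
lie in one of finitely many subspaces of dimension at most `2 * k + 3`, fixed before `A` is drawn.
For `m > C k d log n`, nets and a union bound make `A` nearly isometric on all of them at once, with
little energy on any small set of rows (`IsWellConditionedOn`).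

Put `u = x - x*` and `h = x' - x*`, where `x'` is the next iterate. Optimality of the projection
gives `‖h‖² ≤ 2⟪h, w - x*⟫`, and `w - x* = u - η AᵀA u + η Aᵀ r`, where `r` collects the errors
caused by wrong phases. Near-isometry and `η ≈ 1` make the first two terms contribute little. An
entry of `r` can be nonzero only where `|(A x*)ᵢ| ≤ |(A u)ᵢ|`, and is then at most `2 |(A u)ᵢ|`.
Such indices are rare: few entries of `A x*` are small because `x*` is a fixed vector, and few
entries of `A u` are large because `u` is short (`card_small_measurements_le`). They therefore carry
little energy, which yields `‖h‖ ≤ ‖u‖ / 2` (`phasePGD_step`). The contraction keeps the iterates in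
the basin, so the step can be repeated. -/

/-! ### One-dimensional Gaussian estimates -/

theorem exp_neg_sub_sq_le_one_sub {x : ℝ} (hx : |x| ≤ 1 / 3) :
    Real.exp (-(x + x ^ 2)) ≤ 1 - x := by
  obtain ⟨h1, h2⟩ := abs_le.1 hx
  rw [Real.exp_neg, inv_le_comm₀ (Real.exp_pos _) (by linarith)]
  have key : 1 ≤ (1 - x) * Real.exp (x + x ^ 2) := by
    -- For `x ≤ 0` the linear bound on `exp` suffices, since `(1 - x)(1 + x + x²) = 1 - x³`; for `x
    -- ≥ 0` the second-order term is needed.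
    rcases le_total 0 x with h | h
    · have := Real.quadratic_le_exp_of_nonneg (x := x + x ^ 2) (by positivity)
      calc (1 : ℝ) ≤ (1 - x) * (1 + (x + x ^ 2) + (x + x ^ 2) ^ 2 / 2) := by
            nlinarith [mul_nonneg (sq_nonneg x) (sub_nonneg.2 h2), pow_nonneg h 3, pow_nonneg h 4,
              mul_nonneg (pow_nonneg h 3) (sub_nonneg.2 h2),
              mul_nonneg (pow_nonneg h 4) (sub_nonneg.2 h2)]
        _ ≤ _ := by gcongr; linarith
    · have := Real.add_one_le_exp (x + x ^ 2)
      calc (1 : ℝ) ≤ (1 - x) * (x + x ^ 2 + 1) := by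
            nlinarith [mul_nonneg (sq_nonneg x) (neg_nonneg.2 h)]
        _ ≤ _ := by gcongr; linarith
  rw [inv_le_iff_one_le_mul₀ (by linarith)]
  linarith

/-- Controls the moment generating function of a squared standard Gaussian: after centring, only `2
l²` is left in the exponent. -/
theorem inv_sqrt_one_sub_two_mul_le_exp {l : ℝ} (hl : |l| ≤ 1 / 6) :
    (√(1 - 2 * l))⁻¹ ≤ Real.exp (l + 2 * l ^ 2) := by
  have h := exp_neg_sub_sq_le_one_sub (x := 2 * l) (by rw [abs_mul, abs_two]; linarith)
  have h2 : Real.exp (-(l + 2 * l ^ 2)) ≤ √(1 - 2 * l) := by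
    apply Real.le_sqrt_of_sq_le
    rw [← Real.exp_nat_mul]
    convert h using 2
    push_cast; ring
  calc (√(1 - 2 * l))⁻¹ ≤ (Real.exp (-(l + 2 * l ^ 2)))⁻¹ := by gcongr
    _ = _ := by rw [Real.exp_neg, inv_inv]

theorem lintegral_exp_mul_sq_gaussianReal {l : ℝ} (hl : l < 1 / 2) :
    ∫⁻ x, ENNReal.ofReal (Real.exp (l * x ^ 2)) ∂gaussianReal 0 1
      = ENNReal.ofReal (√(1 - 2 * l))⁻¹ := by
  have hb : 0 < 1 / 2 - l := by linarith
  have hpt : ∀ x : ℝ, gaussianPDFReal 0 1 x * Real.exp (l * x ^ 2)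
      = (√(2 * Real.pi))⁻¹ * Real.exp (-(1 / 2 - l) * x ^ 2) := by
    intro x
    simp only [gaussianPDFReal_def, NNReal.coe_one, mul_one, sub_zero]
    rw [mul_assoc, ← Real.exp_add]
    congr 2; ring
  rw [gaussianReal_of_var_ne_zero _ one_ne_zero,
    lintegral_withDensity_eq_lintegral_mul _ (measurable_gaussianPDF 0 1) (by fun_prop)]
  have : ∀ x : ℝ, (gaussianPDF 0 1 * fun x => ENNReal.ofReal (Real.exp (l * x ^ 2))) x
      = ENNReal.ofReal ((√(2 * Real.pi))⁻¹ * Real.exp (-(1 / 2 - l) * x ^ 2)) := by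
    intro x
    rw [Pi.mul_apply, gaussianPDF, ← ENNReal.ofReal_mul (gaussianPDFReal_nonneg _ _ _), hpt]
  simp_rw [this]
  rw [← ofReal_integral_eq_lintegral_ofReal
    ((integrable_exp_neg_mul_sq hb).const_mul _) (Filter.Eventually.of_forall fun x => by positivity),
    integral_const_mul, integral_gaussian]
  congr 1
  rw [← Real.sqrt_inv, ← Real.sqrt_inv, ← Real.sqrt_mul (by positivity)]
  congr 1
  have := Real.pi_pos.ne'
  have : (1 - 2 * l) ≠ 0 := by linarith
  field_simp

/-- The density is at most `1 / √(2π) ≤ 1/2` and the interval has length `2t`. -/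
theorem gaussianReal_abs_le_le (t : ℝ) :
    gaussianReal 0 1 {x | |x| ≤ t} ≤ ENNReal.ofReal t := by
  rw [gaussianReal_apply _ one_ne_zero]
  have hb : ∀ x, gaussianPDF 0 1 x ≤ ENNReal.ofReal (1 / 2) := by
    intro x
    apply ENNReal.ofReal_le_ofReal
    simp only [gaussianPDFReal_def, NNReal.coe_one, mul_one, sub_zero]
    have h1 : Real.exp (-x ^ 2 / 2) ≤ 1 := Real.exp_le_one_iff.2 (by nlinarith [sq_nonneg x])
    have h2 : (2 : ℝ) ≤ √(2 * Real.pi) := by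
      apply Real.le_sqrt_of_sq_le; nlinarith [Real.pi_gt_three]
    calc (√(2 * Real.pi))⁻¹ * Real.exp (-x ^ 2 / 2) ≤ 2⁻¹ * 1 := by gcongr
      _ = 1 / 2 := by norm_num
  calc ∫⁻ x in {x | |x| ≤ t}, gaussianPDF 0 1 x
      ≤ ∫⁻ _ in {x | |x| ≤ t}, ENNReal.ofReal (1 / 2) := lintegral_mono hb
    _ = ENNReal.ofReal (1 / 2) * volume (Set.Icc (-t) t) := by
        rw [setLIntegral_const]; congr 2; ext x; simp [abs_le]
    _ = ENNReal.ofReal t := by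
        rw [Real.volume_Icc, ← ENNReal.ofReal_mul (by norm_num)]; congr 1; ring

/-- By independence the characteristic function factors, and the exponents add up to `t²/2 · ∑ vⱼ² =
t²/2`; the factor `√m` undoes the variance `1/m`. -/
theorem map_linear_pi_gaussianReal {m n : ℕ} (hm : 0 < m) (v : EuclideanSpace ℝ (Fin n))
    (hv : ‖v‖ = 1) :
    (Measure.pi fun _ : Fin n => gaussianReal 0 (1 / (m : ℝ≥0))).map
      (fun a => √m * ∑ j, a j * v j) = gaussianReal 0 1 := by
  apply Measure.ext_of_charFun
  ext t
  have hmeas : Measurable fun a : Fin n → ℝ => √m * ∑ j, a j * v j := by fun_prop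
  rw [charFun_apply_real, integral_map hmeas.aemeasurable (by fun_prop), charFun_gaussianReal]
  have h1 : ∀ a : Fin n → ℝ, Complex.exp (t * ((√m * ∑ j, a j * v j : ℝ) : ℂ) * Complex.I)
      = ∏ j, Complex.exp (((t * √m * v j : ℝ) : ℂ) * a j * Complex.I) := by
    intro a
    rw [← Complex.exp_sum]
    congr 1
    push_cast
    rw [Finset.mul_sum, Finset.mul_sum, Finset.sum_mul]
    exact Finset.sum_congr rfl fun j _ => by ring
  simp_rw [h1]
  rw [integral_fintype_prod_eq_prod (𝕜 := ℂ)
    (f := fun j (x : ℝ) => Complex.exp (((t * √m * v j : ℝ) : ℂ) * x * Complex.I))]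
  simp_rw [← charFun_apply_real, charFun_gaussianReal]
  rw [← Complex.exp_sum]
  congr 1
  have hsum : ∑ j, (v j) ^ 2 = 1 := by
    rw [← EuclideanSpace.real_norm_sq_eq, hv, one_pow]
  have hm' : (m : ℝ) ≠ 0 := by positivity
  have h2 : ∀ j, ((1 / (m : ℝ≥0) : ℝ≥0) : ℝ) * (t * √m * v j) ^ 2 / 2 = t ^ 2 / 2 * (v j) ^ 2 := by
    intro j
    rw [mul_pow, mul_pow, Real.sq_sqrt (by positivity)]
    push_cast
    field_simp
  have h3 : ∑ j, ((1 / (m : ℝ≥0) : ℝ≥0) : ℝ) * (t * √m * v j) ^ 2 / 2 = t ^ 2 / 2 := by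
    simp_rw [h2]; rw [← Finset.mul_sum, hsum, mul_one]
  have h4 := congrArg (fun r : ℝ => (r : ℂ)) h3
  push_cast at h4
  simp only [Complex.ofReal_zero, mul_zero, zero_mul, zero_sub, Finset.sum_neg_distrib]
  push_cast
  rw [h4]; ring

/-! ### Concentration for a fixed vector -/

/-- Chernoff bound for a sum of a function of the measurements of a fixed unit vector. -/
theorem gaussianMatrix_chernoff {m n : ℕ} (hm : 0 < m) (v : EuclideanSpace ℝ (Fin n))
    (hv : ‖v‖ = 1) {f : ℝ → ℝ} (hf : Measurable f) {c : ℝ}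
    (hc : ∫⁻ x, ENNReal.ofReal (Real.exp (f x)) ∂gaussianReal 0 1 ≤ ENNReal.ofReal (Real.exp c))
    (s : ℝ) :
    gaussianMatrix m n {A | s ≤ ∑ i, f (√m * (Matrix.of A *ᵥ v.ofLp) i)}
      ≤ ENNReal.ofReal (Real.exp (c * m - s)) := by
  set μ := Measure.pi fun _ : Fin n => gaussianReal 0 (1 / (m : ℝ≥0)) with hμ
  set X : (Fin n → ℝ) → ENNReal := fun a => ENNReal.ofReal (Real.exp (f (√m * ∑ j, a j * v j)))
  have hX : Measurable X := by fun_prop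
  have hE : ∫⁻ a, X a ∂μ ≤ ENNReal.ofReal (Real.exp c) := by
    refine le_trans (le_of_eq ?_) hc
    rw [← map_linear_pi_gaussianReal hm v hv, lintegral_map (by fun_prop) (by fun_prop)]
  have hprod : ∫⁻ A, ∏ i, X (A i) ∂gaussianMatrix m n = ∏ _i : Fin m, ∫⁻ a, X a ∂μ := by
    rw [lintegral_prod_eq_prod_lintegral_of_indepFun Finset.univ
      (fun i (A : Fin m → Fin n → ℝ) => X (A i)) (μ := gaussianMatrix m n)
      (iIndepFun_pi (X := fun _ => X) fun _ => hX.aemeasurable)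
      (fun i => hX.comp (measurable_pi_apply i))]
    refine Finset.prod_congr rfl fun i _ => ?_
    have := (measurePreserving_eval (fun _ : Fin m => μ) i).lintegral_comp hX
    exact this
  have hsub : {A : Fin m → Fin n → ℝ | s ≤ ∑ i, f (√m * (Matrix.of A *ᵥ v.ofLp) i)}
      ⊆ {A | ENNReal.ofReal (Real.exp s) ≤ ∏ i, X (A i)} := by
    intro A hA
    simp only [Set.mem_ofPred_eq] at hA ⊢
    rw [← ENNReal.ofReal_prod_of_nonneg fun i _ => (Real.exp_pos _).le, ← Real.exp_sum]
    exact ENNReal.ofReal_le_ofReal (Real.exp_le_exp.2 hA)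
  have hpos : ENNReal.ofReal (Real.exp s) ≠ 0 := by simp [Real.exp_pos]
  calc _ ≤ gaussianMatrix m n {A | ENNReal.ofReal (Real.exp s) ≤ ∏ i, X (A i)} := measure_mono hsub
    _ ≤ (∫⁻ A, ∏ i, X (A i) ∂gaussianMatrix m n) / ENNReal.ofReal (Real.exp s) :=
        meas_ge_le_lintegral_div
          (Finset.measurable_prod _ fun i _ => hX.comp (measurable_pi_apply i)).aemeasurable
          hpos ENNReal.ofReal_ne_top
    _ ≤ ENNReal.ofReal (Real.exp c) ^ m / ENNReal.ofReal (Real.exp s) := by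
        rw [hprod, Finset.prod_const, Finset.card_univ, Fintype.card_fin]
        gcongr
    _ = _ := by
        rw [← ENNReal.ofReal_pow (Real.exp_pos _).le, ← ENNReal.ofReal_div_of_pos (Real.exp_pos _),
          ← Real.exp_nat_mul, ← Real.exp_sub, mul_comm]

/-- The sign of `l` is free so that one bound serves both tails. -/
theorem gaussianMatrix_quadratic_chernoff {m n : ℕ} (hm : 0 < m) (v : EuclideanSpace ℝ (Fin n))
    (hv : ‖v‖ = 1) {l : ℝ} (hl : |l| ≤ 1 / 6) (s : ℝ) :
    gaussianMatrix m n {A | s ≤ l * ∑ i, m * ((Matrix.of A *ᵥ v.ofLp) i) ^ 2}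
      ≤ ENNReal.ofReal (Real.exp ((l + 2 * l ^ 2) * m - s)) := by
  have h := gaussianMatrix_chernoff hm v hv (f := fun x => l * x ^ 2) (by fun_prop)
    (c := l + 2 * l ^ 2)
    ((lintegral_exp_mul_sq_gaussianReal (by linarith [(abs_le.1 hl).2])).trans_le
      (ENNReal.ofReal_le_ofReal (inv_sqrt_one_sub_two_mul_le_exp hl))) s
  simpa only [mul_pow, Real.sq_sqrt (Nat.cast_nonneg m), ← Finset.mul_sum] using h

/-- The energy of a fixed unit vector concentrates: `|‖A v‖² - 1| < 1/64` with high probability. -/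
theorem gaussianMatrix_norm_sq_concentration {m n : ℕ} (hm : 0 < m) (v : EuclideanSpace ℝ (Fin n))
    (hv : ‖v‖ = 1) :
    gaussianMatrix m n {A | 1 / 64 ≤ |∑ i, ((Matrix.of A *ᵥ v.ofLp) i) ^ 2 - 1|}
      ≤ 2 * ENNReal.ofReal (Real.exp (-(m / 32768))) := by
  -- `l = 1/256` minimises `2 l² - l/64`, with value `-1/32768`.
  have hu := gaussianMatrix_quadratic_chernoff hm v hv (l := 1 / 256)
    (by rw [abs_of_pos] <;> norm_num) (1 / 256 * (m * (1 + 1 / 64)))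
  have hd := gaussianMatrix_quadratic_chernoff hm v hv (l := -(1 / 256))
    (by rw [abs_neg, abs_of_pos] <;> norm_num) (-(1 / 256) * (m * (1 - 1 / 64)))
  have hm' : (0 : ℝ) < m := by exact_mod_cast hm
  refine (measure_mono (t := _ ∪ _) ?_).trans ((measure_union_le _ _).trans
    ((add_le_add hu hd).trans (le_of_eq ?_)))
  · intro A hA
    simp only [Set.mem_ofPred_eq, Set.mem_union, ← Finset.mul_sum] at hA ⊢
    rcases le_abs.1 hA with h | h
    · left
      gcongr
      linarith
    · right
      have : (m : ℝ) * ∑ i, ((Matrix.of A *ᵥ v.ofLp) i) ^ 2 ≤ m * (1 - 1 / 64) := by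
        gcongr; linarith
      linarith
  · rw [two_mul (ENNReal.ofReal _), show (1 / 256 + 2 * (1 / 256) ^ 2 : ℝ) * m - 1 / 256 * (m * (1 + 1 / 64))
        = -(m / 32768) by ring, show (-(1 / 256) + 2 * (-(1 / 256)) ^ 2 : ℝ) * m
        - -(1 / 256) * (m * (1 - 1 / 64)) = -(m / 32768) by ring]

/-- The truncated energy of a fixed unit vector is small with high probability. -/
theorem gaussianMatrix_truncated_energy {m n : ℕ} (hm : 0 < m) (v : EuclideanSpace ℝ (Fin n))
    (hv : ‖v‖ = 1) :
    gaussianMatrix m n {A | (m : ℝ) / 128 ≤ ∑ i, max (m * ((Matrix.of A *ᵥ v.ofLp) i) ^ 2 - 32) 0}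
      ≤ ENNReal.ofReal (Real.exp (-(m / 1024))) := by
  have hexp8 : Real.exp (-8) * √2 ≤ 1 / 1024 := by
    have h1 : (2.7 : ℝ) ^ 8 ≤ Real.exp 8 := by
      rw [show (8 : ℝ) = (8 : ℕ) * 1 by norm_num, Real.exp_nat_mul]
      gcongr
      linarith [Real.exp_one_gt_d9]
    have h2 : √2 ≤ 1.5 := Real.sqrt_le_iff.2 ⟨by norm_num, by norm_num⟩
    rw [Real.exp_neg, inv_mul_le_iff₀ (Real.exp_pos _)]
    refine h2.trans ?_
    norm_num at h1 ⊢
    linarith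
  -- The integrand is at most `1 + e⁻⁸ exp(x²/4)`, and the Gaussian mean of `exp(x²/4)` is `√2`.
  -- Truncating at 32 thus makes the exponent `1/1024`, below the `1/512` gained from the threshold.
  have hc : ∫⁻ x, ENNReal.ofReal (Real.exp (1 / 4 * max (x ^ 2 - 32) 0)) ∂gaussianReal 0 1
      ≤ ENNReal.ofReal (Real.exp (1 / 1024)) := by
    calc ∫⁻ x, ENNReal.ofReal (Real.exp (1 / 4 * max (x ^ 2 - 32) 0)) ∂gaussianReal 0 1
        ≤ ∫⁻ x, (1 + ENNReal.ofReal (Real.exp (-8)) * ENNReal.ofReal (Real.exp (1 / 4 * x ^ 2)))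
            ∂gaussianReal 0 1 := by
          refine lintegral_mono fun x => ?_
          rw [← ENNReal.ofReal_mul (Real.exp_pos _).le, ← Real.exp_add, ← ENNReal.ofReal_one,
            ← ENNReal.ofReal_add zero_le_one (Real.exp_pos _).le]
          apply ENNReal.ofReal_le_ofReal
          rcases le_total (x ^ 2 - 32) 0 with h | h
          · rw [max_eq_right h]; simp [Real.exp_nonneg]
          · rw [max_eq_left h, show 1 / 4 * (x ^ 2 - 32) = -8 + 1 / 4 * x ^ 2 by ring]
            linarith
      _ = ENNReal.ofReal (1 + Real.exp (-8) * √2) := by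
          rw [lintegral_add_left measurable_const, lintegral_const_mul _ (by fun_prop),
            lintegral_exp_mul_sq_gaussianReal (by norm_num), lintegral_const, measure_univ, mul_one,
            ← ENNReal.ofReal_mul (Real.exp_pos _).le, ← ENNReal.ofReal_one,
            ← ENNReal.ofReal_add zero_le_one (by positivity)]
          congr 3
          rw [← Real.sqrt_inv]
          norm_num
      _ ≤ _ := ENNReal.ofReal_le_ofReal (by linarith [Real.add_one_le_exp (1 / 1024 : ℝ)])
  have h := gaussianMatrix_chernoff hm v hv (f := fun x => 1 / 4 * max (x ^ 2 - 32) 0)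
    (by fun_prop) hc (1 / 4 * (m / 128))
  simp only [mul_pow, Real.sq_sqrt (Nat.cast_nonneg m), ← Finset.mul_sum] at h
  refine (measure_mono ?_).trans (h.trans (le_of_eq ?_))
  · intro A hA
    simp only [Set.mem_ofPred_eq] at hA ⊢
    gcongr
  · congr 2; ring

/-- Few measurements of a fixed unit vector are small. -/
theorem gaussianMatrix_small_count {m n : ℕ} (hm : 0 < m) (v : EuclideanSpace ℝ (Fin n))
    (hv : ‖v‖ = 1) {a : ℝ} (ha : 0 ≤ a) :
    gaussianMatrix m n {A | a / 2 * m ≤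
        (Finset.univ.filter fun i => |√m * (Matrix.of A *ᵥ v.ofLp) i| ≤ a / 8).card}
      ≤ ENNReal.ofReal (Real.exp (-(a / 4 * m))) := by
  classical
  have hms : MeasurableSet {x : ℝ | |x| ≤ a / 8} := measurableSet_le (by fun_prop) (by fun_prop)
  -- As `e ≤ 3`, the integrand is at most one plus twice the indicator, whose mean is at most `a/8`.
  have hc : ∫⁻ x, ENNReal.ofReal (Real.exp (if |x| ≤ a / 8 then 1 else 0)) ∂gaussianReal 0 1
      ≤ ENNReal.ofReal (Real.exp (a / 4)) := by
    calc ∫⁻ x, ENNReal.ofReal (Real.exp (if |x| ≤ a / 8 then 1 else 0)) ∂gaussianReal 0 1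
        ≤ ∫⁻ x, (1 + 2 * Set.indicator {x : ℝ | |x| ≤ a / 8} 1 x) ∂gaussianReal 0 1 := by
          refine lintegral_mono fun x => ?_
          by_cases h : |x| ≤ a / 8
          · rw [if_pos h, Set.indicator_of_mem (by exact h), Pi.one_apply, mul_one,
              ENNReal.ofReal_le_iff_le_toReal (by simp)]
            have : ((1 + 2 : ENNReal)).toReal = 3 := by norm_num
            rw [this]
            linarith [Real.exp_one_lt_d9]
          · simp [h]
      _ ≤ ENNReal.ofReal (1 + 2 * (a / 8)) := by
          rw [lintegral_add_left measurable_const, lintegral_const_mul _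
            (measurable_one.indicator hms), lintegral_indicator_one hms, lintegral_const,
            measure_univ, mul_one, ENNReal.ofReal_add zero_le_one (by positivity),
            ENNReal.ofReal_one, ENNReal.ofReal_mul zero_le_two, ENNReal.ofReal_ofNat]
          gcongr
          exact gaussianReal_abs_le_le _
      _ ≤ _ := ENNReal.ofReal_le_ofReal (by linarith [Real.add_one_le_exp (a / 4)])
  have h := gaussianMatrix_chernoff hm v hv (f := fun x => if |x| ≤ a / 8 then 1 else 0)
    (Measurable.ite hms measurable_const measurable_const) hc (a / 2 * m)
  simp only [Finset.sum_boole] at h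
  refine h.trans (le_of_eq ?_)
  congr 2; ring

/-! ### Counting the affine pieces of a ReLU network -/

theorem sum_choose_le_succ_pow (q D : ℕ) :
    ∑ j ∈ Finset.Iic D, q.choose j ≤ (q + 1) ^ D := by
  rw [add_pow, show Finset.Iic D = Finset.range (D + 1) by ext; simp]
  refine Finset.sum_le_sum fun j hj => ?_
  have hj' : j ≤ D := Nat.lt_succ_iff.1 (Finset.mem_range.1 hj)
  rw [one_pow, mul_one, Nat.cast_id]
  exact (Nat.choose_le_pow q j).trans (Nat.le_mul_of_pos_right _ (Nat.choose_pos hj'))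

/-- A Sauer–Shelah count: `q` affine functionals on `ℝᵏ` have at most `(q + 1) ^ (k + 1)`
positivity patterns. -/
theorem card_positivity_patterns_le {k q : ℕ}
    (f : Fin q → (EuclideanSpace ℝ (Fin k) →ᵃ[ℝ] ℝ)) (𝒜 : Finset (Finset (Fin q)))
    (h𝒜 : ∀ S ∈ 𝒜, ∃ z, ∀ i, i ∈ S ↔ 0 < f i z) :
    𝒜.card ≤ (q + 1) ^ (k + 1) := by
  -- Affine functionals on `ℝᵏ` form a space of dimension `k + 1`, so those of a larger shattered
  -- set satisfy `∑ cᵢ fᵢ = 0`. At a point realising the pattern `{i | 0 < cᵢ}` every term `cᵢ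
  -- fᵢ(z)` is nonnegative and one is positive, a contradiction.
  have hvc : 𝒜.vcDim ≤ k + 1 := by
    refine Finset.sup_le fun s hs => ?_
    rw [Finset.mem_shatterer] at hs
    by_contra! hcard
    have hdep : ¬ LinearIndependent ℝ
        (fun i : s => ((f i).linear, f i 0) : s → (EuclideanSpace ℝ (Fin k) →ₗ[ℝ] ℝ) × ℝ) := by
      intro hli
      have := hli.fintype_card_le_finrank
      rw [Module.finrank_prod, Module.finrank_linearMap] at this
      simp at this
      omega
    -- A positive coefficient is required because indices outside the pattern only give `fᵢ(z) ≤ 0`;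
    -- the relation is negated if necessary.
    obtain ⟨c, hc0, hc1⟩ : ∃ c : s → ℝ, (∑ i, c i • ((f i).linear, f i 0) = 0) ∧ ∃ i, 0 < c i := by
      rw [Fintype.not_linearIndependent_iff] at hdep
      obtain ⟨c, hc, i, hi⟩ := hdep
      rcases lt_or_gt_of_ne hi with h | h
      · refine ⟨-c, ?_, i, by simpa using h⟩
        refine Eq.trans ?_ (neg_eq_zero.2 hc)
        rw [← Finset.sum_neg_distrib]
        exact Finset.sum_congr rfl fun i _ => Prod.ext (LinearMap.ext fun z => by simp) (by simp)
      · exact ⟨c, hc, i, h⟩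
    obtain ⟨i₀, hi₀⟩ := hc1
    obtain ⟨S, hS, hSs⟩ := hs (t := (Finset.univ.filter fun i : s => 0 < c i).map
      (Function.Embedding.subtype _)) (by
        intro i hi
        obtain ⟨j, _, rfl⟩ := Finset.mem_map.1 hi
        exact j.2)
    obtain ⟨z, hz⟩ := h𝒜 S hS
    have hmem : ∀ i : s, 0 < f i z ↔ 0 < c i := by
      intro i
      rw [← hz]
      have := Finset.ext_iff.1 hSs i
      simpa using this
    have hsum : ∑ i, c i * f i z = 0 := by
      have h1 := congrArg (fun p : (EuclideanSpace ℝ (Fin k) →ₗ[ℝ] ℝ) × ℝ => p.1 z + p.2) hc0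
      simp only [Prod.fst_sum, Prod.snd_sum, Prod.smul_mk, LinearMap.sum_apply, LinearMap.smul_apply,
        smul_eq_mul, Prod.fst_zero, Prod.snd_zero, LinearMap.zero_apply, add_zero,
        ← Finset.sum_add_distrib, ← mul_add] at h1
      rw [← h1]
      refine Finset.sum_congr rfl fun i _ => ?_
      rw [AffineMap.decomp' (f i)]
      simp
    have hnonneg : ∀ i, 0 ≤ c i * f i z := by
      intro i
      rcases lt_or_ge 0 (c i) with h | h
      · exact (mul_pos h ((hmem i).2 h)).le
      · exact mul_nonneg_of_nonpos_of_nonpos h (not_lt.1 fun h' => absurd ((hmem i).1 h') h.not_gt)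
    have := (Finset.sum_eq_zero_iff_of_nonneg fun i _ => hnonneg i).1 hsum i₀ (Finset.mem_univ _)
    exact (mul_pos hi₀ ((hmem i₀).2 hi₀)).ne' this
  calc 𝒜.card ≤ 𝒜.shatterer.card := Finset.card_le_card_shatterer 𝒜
    _ ≤ ∑ j ∈ Finset.Iic 𝒜.vcDim, (Fintype.card (Fin q)).choose j :=
        Finset.card_shatterer_le_sum_vcDim
    _ ≤ (q + 1) ^ 𝒜.vcDim := by rw [Fintype.card_fin]; exact sum_choose_le_succ_pow q _
    _ ≤ _ := Nat.pow_le_pow_right (Nat.succ_pos q) hvc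

/-- The affine map computed by `affineLayer`. -/
noncomputable def affineLayerMap {p q : ℕ} (W : Matrix (Fin q) (Fin p) ℝ) (b : Fin q → ℝ) :
    EuclideanSpace ℝ (Fin p) →ᵃ[ℝ] EuclideanSpace ℝ (Fin q) where
  toFun := affineLayer W b
  linear := Matrix.toEuclideanLin W
  map_vadd' x v := by
    ext i
    simp [affineLayer, Matrix.mulVec_add]
    ring

/-- Keep the coordinates in `S` and set the others to zero. -/
noncomputable def coordinateMask {q : ℕ} (S : Finset (Fin q)) :
    EuclideanSpace ℝ (Fin q) →ₗ[ℝ] EuclideanSpace ℝ (Fin q) where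
  toFun v := WithLp.toLp 2 fun i => if i ∈ S then v i else 0
  map_add' u v := by ext i; by_cases h : i ∈ S <;> simp [h]
  map_smul' c v := by ext i; by_cases h : i ∈ S <;> simp [h]

/-- The ReLU of an affine map is piecewise affine with few pieces. -/
theorem exists_affine_pieces_relu {k q : ℕ}
    (φ : EuclideanSpace ℝ (Fin k) →ᵃ[ℝ] EuclideanSpace ℝ (Fin q)) :
    ∃ F : Finset (EuclideanSpace ℝ (Fin k) →ᵃ[ℝ] EuclideanSpace ℝ (Fin q)),
      F.card ≤ (q + 1) ^ (k + 1) ∧ ∀ z, ∃ ψ ∈ F, relu (φ z) = ψ z := by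
  classical
  let P : EuclideanSpace ℝ (Fin k) → Finset (Fin q) := fun z => Finset.univ.filter fun i => 0 < φ z i
  let 𝒜 : Finset (Finset (Fin q)) := Finset.univ.filter fun S => ∃ z, P z = S
  let f : Fin q → (EuclideanSpace ℝ (Fin k) →ᵃ[ℝ] ℝ) := fun i =>
    (EuclideanSpace.proj (𝕜 := ℝ) i : EuclideanSpace ℝ (Fin q) →L[ℝ] ℝ).toLinearMap.toAffineMap.comp φ
  refine ⟨𝒜.image fun S => (coordinateMask S).toAffineMap.comp φ, Finset.card_image_le.trans ?_, ?_⟩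
  · refine card_positivity_patterns_le f 𝒜 fun S hS => ?_
    obtain ⟨z, rfl⟩ := (Finset.mem_filter.1 hS).2
    exact ⟨z, fun i => by simp [P, f]⟩
  · intro z
    refine ⟨_, Finset.mem_image_of_mem _ (Finset.mem_filter.2 ⟨Finset.mem_univ (P z), z, rfl⟩), ?_⟩
    ext i
    by_cases h : 0 < φ z i
    · simp [relu, coordinateMask, P, h, h.le]
    · simp [relu, coordinateMask, P, h, not_lt.1 h]

/-- Every piece of the first layers stays an affine map on the input space `ℝᵏ`, so a new layer
multiplies the count by at most `(N + 1) ^ (k + 1)`: the exponent involves the input dimension, not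
the width. -/
theorem exists_affine_pieces_network {N k d q : ℕ}
    {g : EuclideanSpace ℝ (Fin k) → EuclideanSpace ℝ (Fin q)} (hg : IsReLUNetwork N d g) :
    ∃ F : Finset (EuclideanSpace ℝ (Fin k) →ᵃ[ℝ] EuclideanSpace ℝ (Fin q)),
      F.card ≤ (N + 1) ^ ((k + 1) * d) ∧ ∀ z, ∃ ψ ∈ F, g z = ψ z := by
  classical
  induction hg with
  | input => exact ⟨{AffineMap.id ℝ _}, by simp, fun z => ⟨_, Finset.mem_singleton_self _, rfl⟩⟩
  | @layer d p q g hg hq W b ih =>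
    obtain ⟨F, hF, hgF⟩ := ih
    choose R hR hRz using fun φ : EuclideanSpace ℝ (Fin k) →ᵃ[ℝ] EuclideanSpace ℝ (Fin q) =>
      exists_affine_pieces_relu φ
    refine ⟨F.biUnion fun φ => R ((affineLayerMap W b).comp φ), ?_, fun z => ?_⟩
    · calc _ ≤ ∑ φ ∈ F, (R ((affineLayerMap W b).comp φ)).card := Finset.card_biUnion_le
        _ ≤ ∑ _φ ∈ F, (N + 1) ^ (k + 1) := by
            refine Finset.sum_le_sum fun φ _ => (hR _).trans ?_
            gcongr
        _ = F.card * (N + 1) ^ (k + 1) := by rw [Finset.sum_const, smul_eq_mul]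
        _ ≤ (N + 1) ^ ((k + 1) * d) * (N + 1) ^ (k + 1) := by gcongr
        _ = _ := by rw [← pow_add]; congr 1
    · obtain ⟨φ, hφ, hz⟩ := hgF z
      obtain ⟨ψ, hψ, hz'⟩ := hRz ((affineLayerMap W b).comp φ) z
      exact ⟨ψ, Finset.mem_biUnion.2 ⟨φ, hφ, hψ⟩, by rw [← hz']; simp only [hz]; rfl⟩

theorem exists_affine_pieces_generator {k n d : ℕ}
    {G : EuclideanSpace ℝ (Fin k) → EuclideanSpace ℝ (Fin n)} (hG : IsReLUGenerator d G) :
    1 ≤ d ∧ ∃ F : Finset (EuclideanSpace ℝ (Fin k) →ᵃ[ℝ] EuclideanSpace ℝ (Fin n)),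
      F.card ≤ (n + 1) ^ ((k + 1) * d) ∧ ∀ z, ∃ ψ ∈ F, G z = ψ z := by
  classical
  obtain ⟨d', p, g, W, b, rfl, hg, rfl | rfl⟩ := hG
  · exact ⟨by omega, exists_affine_pieces_network (.layer hg le_rfl W b)⟩
  · obtain ⟨F, hF, hgF⟩ := exists_affine_pieces_network hg
    refine ⟨by omega, F.image fun φ => (affineLayerMap W b).comp φ, ?_, fun z => ?_⟩
    · refine Finset.card_image_le.trans (hF.trans ?_)
      gcongr <;> omega
    · obtain ⟨φ, hφ, hz⟩ := hgF z
      exact ⟨_, Finset.mem_image_of_mem _ hφ, by simp only [hz]; rfl⟩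

/-! ### Nets and bilinear forms -/

/-- A grid net: every subspace of `ℝⁿ` has a finite `1/4`-net of unit vectors for its unit sphere,
of cardinality at most `(8 n + 1) ^ dim`. -/
theorem exists_unit_sphere_net {n : ℕ} (U : Submodule ℝ (EuclideanSpace ℝ (Fin n))) :
    ∃ E : Finset (EuclideanSpace ℝ (Fin n)), E.card ≤ (8 * n + 1) ^ Module.finrank ℝ U ∧
      (∀ e ∈ E, e ∈ U ∧ ‖e‖ = 1) ∧ ∀ u ∈ U, ‖u‖ = 1 → ∃ e ∈ E, ‖u - e‖ ≤ 1 / 4 := by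
  classical
  set D := Module.finrank ℝ U
  have hD : D ≤ n := by simpa using Submodule.finrank_le U
  let b := stdOrthonormalBasis ℝ U
  -- Coordinates in `[-1, 1]` are rounded to multiples of `1/(4n)`. The error is at most `1/(8n)` in
  -- each of `D ≤ n` coordinates, hence `1/8` in all, and normalising costs another `1/8`.
  let grid : Finset (Fin D → ℤ) := Fintype.piFinset fun _ => Finset.Icc (-(4 * n : ℤ)) (4 * n)
  let pt : (Fin D → ℤ) → U := fun c => ∑ j, ((c j : ℝ) / (4 * n)) • b j
  -- The filter removes the zero grid point, which normalisation leaves at zero.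
  let E := (grid.image fun c => ((‖pt c‖⁻¹ • pt c : U) : EuclideanSpace ℝ (Fin n))).filter
    fun e => ‖e‖ = 1
  refine ⟨E, ?_, ?_, ?_⟩
  · refine (Finset.card_filter_le _ _).trans (Finset.card_image_le.trans ?_)
    simp only [grid, Fintype.card_piFinset, Int.card_Icc, Finset.prod_const, Finset.card_univ,
      Fintype.card_fin]
    apply le_of_eq
    congr 1
    omega
  · intro e he
    obtain ⟨he, he1⟩ := Finset.mem_filter.1 he
    obtain ⟨c, _, rfl⟩ := Finset.mem_image.1 he
    exact ⟨Submodule.coe_mem _, he1⟩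
  · intro u hu hu1
    have hn : 0 < n := by
      rcases Nat.eq_zero_or_pos n with rfl | h
      · rw [Subsingleton.elim u 0, norm_zero] at hu1
        exact absurd hu1 zero_ne_one
      · exact h
    have hn' : (0 : ℝ) < n := by exact_mod_cast hn
    let w : U := ⟨u, hu⟩
    have hw1 : ‖w‖ = 1 := hu1
    let c : Fin D → ℤ := fun j => round (4 * n * inner ℝ (b j) w)
    have hcoef : ∀ j, |(inner ℝ (b j) w : ℝ)| ≤ 1 := fun j => by
      have := abs_real_inner_le_norm (b j) w
      rwa [b.orthonormal.1 j, hw1, one_mul] at this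
    have hc : c ∈ grid := by
      rw [Fintype.mem_piFinset]
      intro j
      rw [Finset.mem_Icc]
      have h1 := abs_le.1 (abs_sub_round (4 * n * (inner ℝ (b j) w : ℝ)))
      have h2 := abs_le.1 (hcoef j)
      have h3 : (c j : ℝ) < 4 * n + 1 := by
        have : 4 * n * (inner ℝ (b j) w : ℝ) ≤ 4 * n * 1 := by gcongr; exact h2.2
        simp only [c]; linarith [h1.1]
      have h4 : (-(4 * n) - 1 : ℝ) < c j := by
        have : 4 * n * (-1 : ℝ) ≤ 4 * n * (inner ℝ (b j) w : ℝ) := by gcongr; exact h2.1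
        simp only [c]; linarith [h1.2]
      have h3' : c j < 4 * n + 1 := by exact_mod_cast h3
      have h4' : -(4 * n) - 1 < c j := by exact_mod_cast h4
      omega
    have hdist : ‖w - pt c‖ ≤ 1 / 8 := by
      have hw : w = ∑ j, (inner ℝ (b j) w : ℝ) • b j := (b.sum_repr' w).symm
      have : w - pt c = ∑ j, ((inner ℝ (b j) w : ℝ) - (c j : ℝ) / (4 * n)) • b j := by
        conv_lhs => rw [hw]
        simp only [pt, sub_smul]
        exact (Finset.sum_sub_distrib _ _).symm
      rw [this]
      calc _ ≤ ∑ j : Fin D, ‖((inner ℝ (b j) w : ℝ) - (c j : ℝ) / (4 * n)) • b j‖ :=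
            norm_sum_le _ _
        _ ≤ ∑ _j : Fin D, 1 / (8 * n : ℝ) := by
            refine Finset.sum_le_sum fun j _ => ?_
            rw [norm_smul, b.orthonormal.1 j, mul_one, Real.norm_eq_abs]
            have h1 := abs_sub_round (4 * n * (inner ℝ (b j) w : ℝ))
            have : (inner ℝ (b j) w : ℝ) - (c j : ℝ) / (4 * n)
                = (4 * n * (inner ℝ (b j) w : ℝ) - c j) / (4 * n) := by field_simp
            rw [this, abs_div, abs_of_pos (show (0 : ℝ) < 4 * n by positivity),
              div_le_div_iff₀ (by positivity) (by positivity)]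
            calc _ ≤ 1 / 2 * (8 * n : ℝ) := by gcongr
              _ = _ := by ring
        _ = D / (8 * n : ℝ) := by simp [div_eq_mul_inv]
        _ ≤ n / (8 * n : ℝ) := by gcongr
        _ = 1 / 8 := by field_simp
    have hpt : |1 - ‖pt c‖| ≤ 1 / 8 := by
      have := abs_norm_sub_norm_le w (pt c)
      rw [hw1] at this
      exact this.trans hdist
    have hpos : 0 < ‖pt c‖ := by linarith [(abs_le.1 hpt).2]
    have hunit : ‖(‖pt c‖⁻¹ • pt c : U)‖ = 1 := by
      rw [norm_smul, norm_inv, norm_norm, inv_mul_cancel₀ hpos.ne']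
    refine ⟨_, Finset.mem_filter.2 ⟨Finset.mem_image_of_mem _ hc, hunit⟩, ?_⟩
    have h2 : ‖pt c - ‖pt c‖⁻¹ • pt c‖ ≤ 1 / 8 := by
      have : pt c - ‖pt c‖⁻¹ • pt c = (1 - ‖pt c‖⁻¹) • pt c := by rw [sub_smul, one_smul]
      rw [this, norm_smul, Real.norm_eq_abs, ← abs_norm (pt c), ← abs_mul, sub_mul, abs_norm,
        inv_mul_cancel₀ hpos.ne', one_mul, abs_sub_comm]
      exact hpt
    calc ‖w - ‖pt c‖⁻¹ • pt c‖ ≤ ‖w - pt c‖ + ‖pt c - ‖pt c‖⁻¹ • pt c‖ := norm_sub_le_norm_sub_add_norm_sub ..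
      _ ≤ 1 / 4 := by linarith

/-- A symmetric bilinear form on a subspace is controlled by its diagonal values on a net of the
unit sphere. -/
theorem bilin_le_of_net {n : ℕ} {U : Submodule ℝ (EuclideanSpace ℝ (Fin n))}
    {E : Finset (EuclideanSpace ℝ (Fin n))} (hEU : ∀ e ∈ E, e ∈ U ∧ ‖e‖ = 1)
    (hE : ∀ u ∈ U, ‖u‖ = 1 → ∃ e ∈ E, ‖u - e‖ ≤ 1 / 4)
    (B : LinearMap.BilinForm ℝ (EuclideanSpace ℝ (Fin n))) (hB : ∀ x y, B x y = B y x)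
    {κ : ℝ} (hκ : 0 ≤ κ) (hBE : ∀ e ∈ E, |B e e| ≤ κ) {x y : EuclideanSpace ℝ (Fin n)}
    (hx : x ∈ U) (hy : y ∈ U) : |B x y| ≤ 2 * κ * ‖x‖ * ‖y‖ := by
  -- the maximum of `|B u u|` over the unit sphere of `U`
  obtain ⟨β, hβ0, hβ, hmax⟩ : ∃ β : ℝ, 0 ≤ β ∧ (∀ u ∈ U, |B u u| ≤ β * ‖u‖ ^ 2) ∧
      (β = 0 ∨ ∃ u ∈ U, ‖u‖ = 1 ∧ |B u u| = β) := by
    let K : Set (EuclideanSpace ℝ (Fin n)) := (U : Set _) ∩ Metric.sphere 0 1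
    have hK : IsCompact K := (isCompact_sphere 0 1).inter_left U.closed_of_finiteDimensional
    have hcont : Continuous fun u => |B u u| := by
      have h1 : Continuous fun u => (B u).toContinuousLinearMap := by
        exact LinearMap.continuous_of_finiteDimensional
          ((LinearMap.toContinuousLinearMap : (EuclideanSpace ℝ (Fin n) →ₗ[ℝ] ℝ) ≃ₗ[ℝ] _).toLinearMap.comp B)
      exact (h1.clm_apply continuous_id).abs
    rcases K.eq_empty_or_nonempty with hemp | hne
    · refine ⟨0, le_rfl, fun u hu => ?_, Or.inl rfl⟩
      by_cases h0 : u = 0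
      · simp [h0]
      · exfalso
        have : ‖u‖⁻¹ • u ∈ K := ⟨U.smul_mem _ hu, by simp [norm_smul, h0]⟩
        rw [hemp] at this
        exact this
    · obtain ⟨u₀, hu₀, hu₀max⟩ := hK.exists_isMaxOn hne hcont.continuousOn
      refine ⟨|B u₀ u₀|, abs_nonneg _, fun u hu => ?_, Or.inr ⟨u₀, hu₀.1, by simpa using hu₀.2, rfl⟩⟩
      by_cases h0 : u = 0
      · simp [h0]
      · have hn0 : ‖u‖ ≠ 0 := norm_ne_zero_iff.2 h0
        have hmem : ‖u‖⁻¹ • u ∈ K := ⟨U.smul_mem _ hu, by simp [norm_smul, h0]⟩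
        have h1 : |B (‖u‖⁻¹ • u) (‖u‖⁻¹ • u)| ≤ |B u₀ u₀| := hu₀max hmem
        have h2 : B (‖u‖⁻¹ • u) (‖u‖⁻¹ • u) = B u u / ‖u‖ ^ 2 := by
          simp only [map_smul, LinearMap.smul_apply, smul_eq_mul]
          field_simp
        rw [h2, abs_div, abs_of_pos (show 0 < ‖u‖ ^ 2 by positivity),
          div_le_iff₀ (by positivity)] at h1
        exact h1
  -- Polarisation and the parallelogram law pass from the diagonal to all pairs without loss of
  -- constant.
  have hunit : ∀ p ∈ U, ∀ q ∈ U, ‖p‖ = 1 → ‖q‖ = 1 → |B p q| ≤ β := by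
    intro p hp q hq hp1 hq1
    have h1 := abs_le.1 (hβ (p + q) (U.add_mem hp hq))
    have h2 := abs_le.1 (hβ (p - q) (U.sub_mem hp hq))
    have h3 := parallelogram_law_with_norm ℝ p q
    have h4 : B (p + q) (p + q) - B (p - q) (p - q) = 4 * B p q := by
      simp only [map_add, map_sub, LinearMap.add_apply, LinearMap.sub_apply, hB q p]
      ring
    have h5 : β * (‖p + q‖ ^ 2 + ‖p - q‖ ^ 2) = β * 4 := by
      congr 1; rw [hp1, hq1] at h3; linarith
    rw [abs_le]
    constructor <;> linarith [h1.1, h1.2, h2.1, h2.2]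
  have hgen : ∀ p ∈ U, ∀ q ∈ U, |B p q| ≤ β * ‖p‖ * ‖q‖ := by
    intro p hp q hq
    by_cases hp0 : p = 0
    · simp [hp0]
    by_cases hq0 : q = 0
    · simp [hq0]
    have h1 := hunit (‖p‖⁻¹ • p) (U.smul_mem _ hp) (‖q‖⁻¹ • q) (U.smul_mem _ hq)
      (by simp [norm_smul, hp0]) (by simp [norm_smul, hq0])
    have hp1 : 0 < ‖p‖ := norm_pos_iff.2 hp0
    have hq1 : 0 < ‖q‖ := norm_pos_iff.2 hq0
    have h2 : B (‖p‖⁻¹ • p) (‖q‖⁻¹ • q) = B p q / (‖p‖ * ‖q‖) := by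
      simp only [map_smul, LinearMap.smul_apply, smul_eq_mul]
      field_simp
    rw [h2, abs_div, abs_of_pos (mul_pos hp1 hq1), div_le_iff₀ (mul_pos hp1 hq1)] at h1
    linarith
  -- For a maximiser `u` and a net point `e` near it, `B u u - B e e = B (u - e) (u + e)` is at most
  -- `β/2` in absolute value, so `β ≤ κ + β/2`.
  have hβκ : β ≤ 2 * κ := by
    rcases hmax with h0 | ⟨u, hu, hu1, huβ⟩
    · rw [h0]; positivity
    · obtain ⟨e, he, hue⟩ := hE u hu hu1
      obtain ⟨heU, he1⟩ := hEU e he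
      have h1 : B u u - B e e = B (u - e) (u + e) := by
        simp only [map_add, map_sub, LinearMap.sub_apply, hB e u]
        ring
      have h2 : |B (u - e) (u + e)| ≤ β * (1 / 4) * 2 := by
        refine (hgen _ (U.sub_mem hu heU) _ (U.add_mem hu heU)).trans ?_
        gcongr
        exact (norm_add_le _ _).trans (by rw [hu1, he1]; norm_num)
      have h3 : |B u u| ≤ |B e e| + |B u u - B e e| := by
        have := abs_add_le (B e e) (B u u - B e e)
        rwa [add_sub_cancel] at this
      rw [h1, huβ] at h3
      linarith [hBE e he]
  refine (hgen x hx y hy).trans ?_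
  gcongr

/-! ### Conditioning of the measurements on a subspace -/

/-- The form `(x, y) ↦ ∑ i ∈ T, (A x)ᵢ (A y)ᵢ` of the measurements indexed by `T`. -/
noncomputable def gramForm {m n : ℕ} (A : Matrix (Fin m) (Fin n) ℝ) (T : Finset (Fin m)) :
    LinearMap.BilinForm ℝ (EuclideanSpace ℝ (Fin n)) :=
  LinearMap.mk₂ ℝ (fun x y => ∑ i ∈ T, (A *ᵥ x.ofLp) i * (A *ᵥ y.ofLp) i)
    (fun x x' y => by simp [Matrix.mulVec_add, add_mul, Finset.sum_add_distrib])
    (fun c x y => by simp [Matrix.mulVec_smul, Finset.mul_sum, mul_assoc])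
    (fun x y y' => by simp [Matrix.mulVec_add, mul_add, Finset.sum_add_distrib])
    (fun c x y => by simp [Matrix.mulVec_smul, Finset.mul_sum, mul_left_comm])

theorem gramForm_apply {m n : ℕ} (A : Matrix (Fin m) (Fin n) ℝ) (T : Finset (Fin m))
    (x y : EuclideanSpace ℝ (Fin n)) :
    gramForm A T x y = ∑ i ∈ T, (A *ᵥ x.ofLp) i * (A *ᵥ y.ofLp) i := rfl

theorem gramForm_comm {m n : ℕ} (A : Matrix (Fin m) (Fin n) ℝ) (T : Finset (Fin m))
    (x y : EuclideanSpace ℝ (Fin n)) : gramForm A T x y = gramForm A T y x := by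
  simp only [gramForm_apply, mul_comm]

/-- `A` is nearly isometric on `U`, and any small set of measurements carries little energy. -/
structure IsWellConditionedOn {m n : ℕ} (A : Matrix (Fin m) (Fin n) ℝ)
    (U : Submodule ℝ (EuclideanSpace ℝ (Fin n))) : Prop where
  near_isometry : ∀ x ∈ U, ∀ y ∈ U,
    |gramForm A Finset.univ x y - inner ℝ x y| ≤ 1 / 32 * ‖x‖ * ‖y‖
  small_sets : ∀ T : Finset (Fin m), (T.card : ℝ) ≤ 1 / 4096 * m → ∀ x ∈ U, ∀ y ∈ U,
    |gramForm A T x y| ≤ 1 / 32 * ‖x‖ * ‖y‖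

/-- Few of the measurements of `x` are small. -/
def HasFewSmallMeasurements {m n : ℕ} (A : Matrix (Fin m) (Fin n) ℝ)
    (x : EuclideanSpace ℝ (Fin n)) : Prop :=
  ((Finset.univ.filter fun i => |√m * (A *ᵥ x.ofLp) i| ≤ 1 / 4096 / 8 * ‖x‖).card : ℝ)
    ≤ 1 / 4096 / 2 * m

/-- Truncation avoids a union bound over `T`: `m` times the energy on `T` is at most `32 |T|` plus
the total excess over 32, and each is at most `m/128`. -/
theorem isWellConditionedOn_of_net {m n : ℕ} (hm : 0 < m) {A : Matrix (Fin m) (Fin n) ℝ}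
    {U : Submodule ℝ (EuclideanSpace ℝ (Fin n))}
    {E : Finset (EuclideanSpace ℝ (Fin n))} (hEU : ∀ e ∈ E, e ∈ U ∧ ‖e‖ = 1)
    (hE : ∀ u ∈ U, ‖u‖ = 1 → ∃ e ∈ E, ‖u - e‖ ≤ 1 / 4)
    (h1 : ∀ e ∈ E, |∑ i, ((A *ᵥ e.ofLp) i) ^ 2 - 1| < 1 / 64)
    (h2 : ∀ e ∈ E, ∑ i, max (m * ((A *ᵥ e.ofLp) i) ^ 2 - 32) 0 < (m : ℝ) / 128) :
    IsWellConditionedOn A U where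
  near_isometry x hx y hy := by
    have := bilin_le_of_net hEU hE
      (gramForm A Finset.univ - innerₗ (EuclideanSpace ℝ (Fin n)))
      (fun x y => by
        simp only [LinearMap.sub_apply, innerₗ_apply_apply, gramForm_comm A _ x y,
          real_inner_comm x y])
      (κ := 1 / 64) (by norm_num) (fun e he => by
        simp only [LinearMap.sub_apply, innerₗ_apply_apply, real_inner_self_eq_norm_sq,
          (hEU e he).2, gramForm_apply, ← sq, one_pow]
        exact (h1 e he).le) hx hy
    simp only [LinearMap.sub_apply, innerₗ_apply_apply] at this
    convert this using 3
    norm_num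
  small_sets T hT x hx y hy := by
    have := bilin_le_of_net hEU hE (gramForm A T) (gramForm_comm A T)
      (κ := 1 / 64) (by norm_num) (fun e he => by
        have hm' : (0 : ℝ) < m := by exact_mod_cast hm
        rw [gramForm_apply, abs_of_nonneg (Finset.sum_nonneg fun i _ => mul_self_nonneg _)]
        have h3 : (m : ℝ) * ∑ i ∈ T, (A *ᵥ e.ofLp) i * (A *ᵥ e.ofLp) i ≤ m * (1 / 64) := by
          calc (m : ℝ) * ∑ i ∈ T, (A *ᵥ e.ofLp) i * (A *ᵥ e.ofLp) i
              ≤ ∑ i ∈ T, (32 + max (m * ((A *ᵥ e.ofLp) i) ^ 2 - 32) 0) := by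
                rw [Finset.mul_sum]
                refine Finset.sum_le_sum fun i _ => ?_
                have := le_max_left (m * ((A *ᵥ e.ofLp) i) ^ 2 - 32) 0
                nlinarith
            _ ≤ T.card * 32 + ∑ i, max (m * ((A *ᵥ e.ofLp) i) ^ 2 - 32) 0 := by
                rw [Finset.sum_add_distrib, Finset.sum_const, nsmul_eq_mul]
                exact add_le_add le_rfl
                  (Finset.sum_le_univ_sum_of_nonneg fun i => le_max_right _ _)
            _ ≤ m * (1 / 64) := by linarith [h2 e he]
        exact le_of_mul_le_mul_left h3 hm') hx hy
    convert this using 3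
    norm_num

/-! ### Phase errors and the one-step contraction -/

/-- A wrong phase costs at most twice the error, and can occur only at small measurements. -/
theorem phase_error_bound {a b p : ℝ} (hp : |p| ≤ 1) (hpb : b ≠ 0 → p = Real.sign b) :
    |(|a| * p - a)| ≤ 2 * |b - a| ∧ (|b - a| < |a| → |a| * p - a = 0) := by
  have h0 : |b - a| < |a| → |a| * p - a = 0 := by
    intro h
    rcases lt_trichotomy a 0 with ha | ha | ha
    · rw [abs_of_neg ha] at h ⊢
      have hb : b < 0 := by linarith [(abs_lt.1 h).2]
      rw [hpb hb.ne, Real.sign_of_neg hb]; ring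
    · rw [ha, abs_zero] at h
      exact absurd h (abs_nonneg _).not_gt
    · rw [abs_of_pos ha] at h ⊢
      have hb : 0 < b := by linarith [(abs_lt.1 h).1]
      rw [hpb hb.ne', Real.sign_of_pos hb]; ring
  refine ⟨?_, h0⟩
  rcases lt_or_ge |b - a| |a| with h | h
  · rw [h0 h, abs_zero]; positivity
  · calc |(|a| * p - a)| ≤ |(|a| * p)| + |a| := abs_sub _ _
      _ = |a| * |p| + |a| := by rw [abs_mul, abs_abs]
      _ ≤ |a| * 1 + |a| := by gcongr
      _ ≤ 2 * |b - a| := by linarith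

theorem inner_transpose_mulVec {m n : ℕ} (A : Matrix (Fin m) (Fin n) ℝ) (s : Fin m → ℝ)
    (h : EuclideanSpace ℝ (Fin n)) :
    inner ℝ h (WithLp.toLp 2 (Aᵀ *ᵥ s)) = ∑ i, (A *ᵥ h.ofLp) i * s i := by
  have : inner ℝ h (WithLp.toLp 2 (Aᵀ *ᵥ s)) = (Aᵀ *ᵥ s) ⬝ᵥ h.ofLp := by
    rw [EuclideanSpace.inner_eq_star_dotProduct]; simp
  rw [this, dotProduct_comm, Matrix.dotProduct_mulVec, Matrix.vecMul_transpose]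
  rfl

/-- At such an index either `(A x)ᵢ` is below a threshold or `(A u)ᵢ` is above it. The first is rare
by hypothesis on the single vector `x`; the second is rare by Chebyshev, uniformly in `u ∈ U`, since
`‖A u‖² ≤ 33/32 ‖u‖²`. -/
theorem card_small_measurements_le {m n : ℕ} {A : Matrix (Fin m) (Fin n) ℝ}
    {U : Submodule ℝ (EuclideanSpace ℝ (Fin n))} (hA : IsWellConditionedOn A U)
    {x u : EuclideanSpace ℝ (Fin n)} (hx : HasFewSmallMeasurements A x) (hx0 : x ≠ 0)
    (hu : u ∈ U) (hux : ‖u‖ ≤ (1 / 4096) ^ 2 * ‖x‖) :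
    ((Finset.univ.filter fun i => |(A *ᵥ x.ofLp) i| ≤ |(A *ᵥ u.ofLp) i|).card : ℝ)
      ≤ 1 / 4096 * m := by
  classical
  have hxpos : 0 < ‖x‖ := norm_pos_iff.2 hx0
  set T₁ := Finset.univ.filter fun i => |√m * (A *ᵥ x.ofLp) i| ≤ 1 / 4096 / 8 * ‖x‖
  set T₂ := Finset.univ.filter fun i => 1 / 4096 / 8 * ‖x‖ < |√m * (A *ᵥ u.ofLp) i|
  have hsub : (Finset.univ.filter fun i => |(A *ᵥ x.ofLp) i| ≤ |(A *ᵥ u.ofLp) i|) ⊆ T₁ ∪ T₂ := by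
    intro i hi
    have hi' := (Finset.mem_filter.1 hi).2
    rw [Finset.mem_union, Finset.mem_filter, Finset.mem_filter]
    rcases le_or_gt |√m * (A *ᵥ x.ofLp) i| (1 / 4096 / 8 * ‖x‖) with h | h
    · exact Or.inl ⟨Finset.mem_univ _, h⟩
    · refine Or.inr ⟨Finset.mem_univ _, h.trans_le ?_⟩
      rw [abs_mul, abs_mul]
      gcongr
  have hT₂ : (T₂.card : ℝ) ≤ 1 / 4096 / 2 * m := by
    have hen : gramForm A Finset.univ u u ≤ 33 / 32 * ‖u‖ ^ 2 := by
      have := (abs_le.1 (hA.near_isometry u hu u hu)).2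
      rw [real_inner_self_eq_norm_sq] at this
      nlinarith
    have h1 : (T₂.card : ℝ) * (1 / 4096 / 8 * ‖x‖) ^ 2 ≤ m * gramForm A Finset.univ u u := by
      calc (T₂.card : ℝ) * (1 / 4096 / 8 * ‖x‖) ^ 2
          = ∑ _i ∈ T₂, (1 / 4096 / 8 * ‖x‖) ^ 2 := by rw [Finset.sum_const, nsmul_eq_mul]
        _ ≤ ∑ i ∈ T₂, m * ((A *ᵥ u.ofLp) i * (A *ᵥ u.ofLp) i) := by
            refine Finset.sum_le_sum fun i hi => ?_
            have h2 : (1 / 4096 / 8 * ‖x‖) ^ 2 ≤ |√m * (A *ᵥ u.ofLp) i| ^ 2 := by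
              gcongr
              exact (Finset.mem_filter.1 hi).2.le
            rwa [sq_abs, mul_pow √(m : ℝ), Real.sq_sqrt (Nat.cast_nonneg m), sq ((A *ᵥ u.ofLp) i)] at h2
        _ ≤ ∑ i, m * ((A *ᵥ u.ofLp) i * (A *ᵥ u.ofLp) i) :=
            Finset.sum_le_univ_sum_of_nonneg fun i =>
              mul_nonneg (Nat.cast_nonneg m) (mul_self_nonneg _)
        _ = _ := by rw [← Finset.mul_sum, gramForm_apply]
    have h3 : ‖u‖ ^ 2 ≤ ((1 / 4096) ^ 2 * ‖x‖) ^ 2 := by gcongr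
    have h4 : (T₂.card : ℝ) * (1 / 4096 / 8 * ‖x‖) ^ 2
        ≤ (1 / 4096 / 2 * m) * (1 / 4096 / 8 * ‖x‖) ^ 2 := by
      refine h1.trans ?_
      calc (m : ℝ) * gramForm A Finset.univ u u
          ≤ m * (33 / 32 * ((1 / 4096) ^ 2 * ‖x‖) ^ 2) := by
            gcongr
            exact hen.trans (by gcongr)
        _ ≤ _ := by
            have : 0 ≤ (m : ℝ) * ‖x‖ ^ 2 := by positivity
            nlinarith
    exact le_of_mul_le_mul_right h4 (by positivity)
  have hT₁ : (T₁.card : ℝ) ≤ 1 / 4096 / 2 * m := hx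
  calc ((Finset.univ.filter fun i => |(A *ᵥ x.ofLp) i| ≤ |(A *ᵥ u.ofLp) i|).card : ℝ)
      ≤ ((T₁ ∪ T₂).card : ℝ) := by exact_mod_cast Finset.card_le_card hsub
    _ ≤ T₁.card + T₂.card := by exact_mod_cast Finset.card_union_le _ _
    _ ≤ _ := by linarith

/-- One step of Phase-PGD halves the error. -/
theorem phasePGD_step {m n : ℕ} {A : Matrix (Fin m) (Fin n) ℝ}
    {U : Submodule ℝ (EuclideanSpace ℝ (Fin n))} (hA : IsWellConditionedOn A U)
    {xs x x' : EuclideanSpace ℝ (Fin n)} (hxs : xs ∈ U) (hx : x ∈ U) (hx' : x' ∈ U)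
    (hfew : xs ≠ 0 → HasFewSmallMeasurements A xs) (hclose : ‖x - xs‖ ≤ (1 / 4096) ^ 2 * ‖xs‖)
    {η : ℝ} (hη : η ∈ Set.Icc (15 / 16 : ℝ) (17 / 16)) {p : Fin m → ℝ}
    (hp : IsPhase p (A *ᵥ x.ofLp))
    (hproj : ‖x + η • WithLp.toLp 2 (Aᵀ *ᵥ (phaselessMeasurements A xs * p - A *ᵥ x.ofLp)) - x'‖
      ≤ ‖x + η • WithLp.toLp 2 (Aᵀ *ᵥ (phaselessMeasurements A xs * p - A *ᵥ x.ofLp)) - xs‖) :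
    ‖x' - xs‖ ≤ 1 / 2 * ‖x - xs‖ := by
  classical
  set s : Fin m → ℝ := phaselessMeasurements A xs * p - A *ᵥ x.ofLp with hs
  set w := x + η • WithLp.toLp 2 (Aᵀ *ᵥ s)
  set h := x' - xs with hh
  set u := x - xs with hu
  have hhU : h ∈ U := U.sub_mem hx' hxs
  have huU : u ∈ U := U.sub_mem hx hxs
  set r : Fin m → ℝ := fun i => |(A *ᵥ xs.ofLp) i| * p i - (A *ᵥ xs.ofLp) i with hr
  have hAu : ∀ i, (A *ᵥ u.ofLp) i = (A *ᵥ x.ofLp) i - (A *ᵥ xs.ofLp) i := by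
    intro i; simp [hu, Matrix.mulVec_sub]
  have hrb : ∀ i, |r i| ≤ 2 * |(A *ᵥ u.ofLp) i| ∧
      (|(A *ᵥ u.ofLp) i| < |(A *ᵥ xs.ofLp) i| → r i = 0) := by
    intro i
    rw [hAu]
    exact phase_error_bound (hp i).1 (hp i).2
  -- Only minimality against the competitor `xs` is used; the range of `G` need not be convex.
  have hquad : ‖h‖ ^ 2 ≤ 2 * inner ℝ h (w - xs) := by
    have h1 : w - x' = (w - xs) - h := by rw [hh]; abel
    have h2 : ‖w - x'‖ ^ 2 ≤ ‖w - xs‖ ^ 2 := by gcongr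
    rw [h1, norm_sub_sq_real, real_inner_comm] at h2
    linarith
  have hinner : inner ℝ h (w - xs) = (1 - η) * inner ℝ h u
      - η * (gramForm A Finset.univ h u - inner ℝ h u) + η * ∑ i, (A *ᵥ h.ofLp) i * r i := by
    have h1 : w - xs = u + η • WithLp.toLp 2 (Aᵀ *ᵥ s) := by simp only [w, hu]; abel
    have h2 : ∑ i, (A *ᵥ h.ofLp) i * s i
        = ∑ i, (A *ᵥ h.ofLp) i * r i - gramForm A Finset.univ h u := by
      rw [gramForm_apply, ← Finset.sum_sub_distrib]
      refine Finset.sum_congr rfl fun i _ => ?_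
      rw [hAu]
      simp only [hs, hr, phaselessMeasurements, Pi.sub_apply, Pi.mul_apply]
      ring
    rw [h1, inner_add_right, real_inner_smul_right, inner_transpose_mulVec, h2]
    ring
  -- `r` vanishes off the small set `S`, so Cauchy–Schwarz on `S` applies; the constant is `2 ·
  -- 1/32`.
  have hphase : |∑ i, (A *ᵥ h.ofLp) i * r i| ≤ 1 / 16 * ‖h‖ * ‖u‖ := by
    by_cases hu0 : u = 0
    · have : ∀ i, r i = 0 := fun i => by
        have := (hrb i).1
        rw [hu0] at this
        simpa using this
      simp [this, hu0]
    have hxs0 : xs ≠ 0 := by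
      rintro rfl
      rw [norm_zero, mul_zero, norm_le_zero_iff] at hclose
      exact hu0 hclose
    set S := Finset.univ.filter fun i => |(A *ᵥ xs.ofLp) i| ≤ |(A *ᵥ u.ofLp) i|
    have hS := card_small_measurements_le hA (hfew hxs0) hxs0 huU hclose
    have hsq : ∀ v ∈ U, √(∑ i ∈ S, |(A *ᵥ v.ofLp) i| ^ 2) ≤ √(1 / 32) * ‖v‖ := by
      intro v hv
      have h1 := (le_abs_self _).trans (hA.small_sets S hS v hv v hv)
      rw [gramForm_apply] at h1
      rw [show √(1 / 32) * ‖v‖ = √(1 / 32 * ‖v‖ ^ 2) by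
        rw [Real.sqrt_mul (by norm_num), Real.sqrt_sq (norm_nonneg _)]]
      apply Real.sqrt_le_sqrt
      simp only [sq, abs_mul_abs_self]
      linarith
    calc |∑ i, (A *ᵥ h.ofLp) i * r i| ≤ ∑ i, |(A *ᵥ h.ofLp) i * r i| :=
          Finset.abs_sum_le_sum_abs _ _
      _ = ∑ i ∈ S, |(A *ᵥ h.ofLp) i * r i| := by
          refine (Finset.sum_subset (Finset.subset_univ S) fun i _ hi => ?_).symm
          have : |(A *ᵥ u.ofLp) i| < |(A *ᵥ xs.ofLp) i| := by
            by_contra! hle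
            exact hi (Finset.mem_filter.2 ⟨Finset.mem_univ _, hle⟩)
          rw [(hrb i).2 this, mul_zero, abs_zero]
      _ ≤ ∑ i ∈ S, 2 * (|(A *ᵥ h.ofLp) i| * |(A *ᵥ u.ofLp) i|) := by
          refine Finset.sum_le_sum fun i _ => ?_
          rw [abs_mul]
          calc |(A *ᵥ h.ofLp) i| * |r i| ≤ |(A *ᵥ h.ofLp) i| * (2 * |(A *ᵥ u.ofLp) i|) := by
                gcongr; exact (hrb i).1
            _ = _ := by ring
      _ = 2 * ∑ i ∈ S, |(A *ᵥ h.ofLp) i| * |(A *ᵥ u.ofLp) i| := by rw [Finset.mul_sum]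
      _ ≤ 2 * ((√(1 / 32) * ‖h‖) * (√(1 / 32) * ‖u‖)) := by
          gcongr
          refine (Real.sum_mul_le_sqrt_mul_sqrt _ _ _).trans ?_
          gcongr
          · exact hsq h hhU
          · exact hsq u huU
      _ = 2 * (√(1 / 32) * √(1 / 32)) * ‖h‖ * ‖u‖ := by ring
      _ = 1 / 16 * ‖h‖ * ‖u‖ := by rw [Real.mul_self_sqrt (by norm_num)]; norm_num
  have hnear := hA.near_isometry h hhU u huU
  have hcs := abs_real_inner_le_norm h u
  set P := ‖h‖ * ‖u‖ with hP
  have hP0 : 0 ≤ P := by positivity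
  -- The three terms add up to `1/16 + 17/512 + 17/256 = 83/512 < 1/4`.
  have hbound : inner ℝ h (w - xs) ≤ 1 / 4 * P := by
    have e1 : (1 - η) * inner ℝ h u ≤ 1 / 16 * P := by
      refine (le_abs_self _).trans ?_
      rw [abs_mul]
      gcongr
      rw [abs_le]; constructor <;> linarith [hη.1, hη.2]
    have e2 : η * |gramForm A Finset.univ h u - inner ℝ h u| ≤ 17 / 16 * (1 / 32 * P) := by
      gcongr
      · exact hη.2
      · linarith
    have e3 : η * |∑ i, (A *ᵥ h.ofLp) i * r i| ≤ 17 / 16 * (1 / 16 * P) := by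
      gcongr
      · exact hη.2
      · linarith
    have hη0 : 0 ≤ η := by linarith [hη.1]
    have e4 := mul_le_mul_of_nonneg_left
      (neg_abs_le (gramForm A Finset.univ h u - inner ℝ h u)) hη0
    have e5 := mul_le_mul_of_nonneg_left (le_abs_self (∑ i, (A *ᵥ h.ofLp) i * r i)) hη0
    rw [hinner]
    linarith
  by_cases h0 : ‖h‖ = 0
  · rw [h0]; positivity
  · have hpos : 0 < ‖h‖ := lt_of_le_of_ne (norm_nonneg _) (Ne.symm h0)
    refine le_of_mul_le_mul_left ?_ hpos
    nlinarith

/-! ### From one step to a whole run -/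

/-- The span of two affine pieces and a vector. -/
def pieceSpan {k n : ℕ} (φ ψ : EuclideanSpace ℝ (Fin k) →ᵃ[ℝ] EuclideanSpace ℝ (Fin n))
    (x : EuclideanSpace ℝ (Fin n)) : Submodule ℝ (EuclideanSpace ℝ (Fin n)) :=
  (LinearMap.range φ.linear ⊔ LinearMap.range ψ.linear) ⊔ Submodule.span ℝ {φ 0, ψ 0, x}

theorem finrank_pieceSpan_le {k n : ℕ}
    (φ ψ : EuclideanSpace ℝ (Fin k) →ᵃ[ℝ] EuclideanSpace ℝ (Fin n))
    (x : EuclideanSpace ℝ (Fin n)) : Module.finrank ℝ (pieceSpan φ ψ x) ≤ 2 * k + 3 := by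
  classical
  have h1 : ∀ χ : EuclideanSpace ℝ (Fin k) →ᵃ[ℝ] EuclideanSpace ℝ (Fin n),
      Module.finrank ℝ (LinearMap.range χ.linear) ≤ k := fun χ => by
    simpa using LinearMap.finrank_range_le χ.linear
  have h2 : Module.finrank ℝ (Submodule.span ℝ ({φ 0, ψ 0, x} : Set (EuclideanSpace ℝ (Fin n))))
      ≤ 3 := by
    have := finrank_span_finset_le_card (R := ℝ) ({φ 0, ψ 0, x} : Finset (EuclideanSpace ℝ (Fin n)))
    rw [Finset.coe_insert, Finset.coe_insert, Finset.coe_singleton] at this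
    exact this.trans Finset.card_le_three
  have h3 := Submodule.finrank_add_le_finrank_add_finrank (LinearMap.range φ.linear)
    (LinearMap.range ψ.linear)
  have h4 := Submodule.finrank_add_le_finrank_add_finrank
    (LinearMap.range φ.linear ⊔ LinearMap.range ψ.linear) (Submodule.span ℝ {φ 0, ψ 0, x})
  have := h1 φ
  have := h1 ψ
  unfold pieceSpan
  omega

theorem mem_pieceSpan {k n : ℕ}
    (φ ψ : EuclideanSpace ℝ (Fin k) →ᵃ[ℝ] EuclideanSpace ℝ (Fin n))
    (x : EuclideanSpace ℝ (Fin n)) (z : EuclideanSpace ℝ (Fin k)) :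
    φ z ∈ pieceSpan φ ψ x ∧ ψ z ∈ pieceSpan φ ψ x ∧ x ∈ pieceSpan φ ψ x := by
  have hdec : ∀ χ : EuclideanSpace ℝ (Fin k) →ᵃ[ℝ] EuclideanSpace ℝ (Fin n),
      χ z = χ.linear z + χ 0 := fun χ => congrFun (AffineMap.decomp χ) z
  have hspan : ∀ y ∈ ({φ 0, ψ 0, x} : Set (EuclideanSpace ℝ (Fin n))), y ∈ pieceSpan φ ψ x :=
    fun y hy => (le_sup_right : _ ≤ pieceSpan φ ψ x) (Submodule.subset_span hy)
  refine ⟨?_, ?_, hspan _ (by simp)⟩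
  · rw [hdec φ]
    exact Submodule.add_mem _ ((le_sup_left : _ ≤ pieceSpan φ ψ x)
      ((le_sup_left : _ ≤ LinearMap.range φ.linear ⊔ LinearMap.range ψ.linear)
        (LinearMap.mem_range_self _ _))) (hspan _ (by simp))
  · rw [hdec ψ]
    exact Submodule.add_mem _ ((le_sup_left : _ ≤ pieceSpan φ ψ x)
      ((le_sup_right : _ ≤ LinearMap.range φ.linear ⊔ LinearMap.range ψ.linear)
        (LinearMap.mem_range_self _ _))) (hspan _ (by simp))

theorem HasFewSmallMeasurements.neg {m n : ℕ} {A : Matrix (Fin m) (Fin n) ℝ}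
    {x : EuclideanSpace ℝ (Fin n)} (h : HasFewSmallMeasurements A x) :
    HasFewSmallMeasurements A (-x) := by
  simpa [HasFewSmallMeasurements, Matrix.mulVec_neg] using h

theorem phaselessMeasurements_neg {m n : ℕ} (A : Matrix (Fin m) (Fin n) ℝ)
    (x : EuclideanSpace ℝ (Fin n)) :
    phaselessMeasurements A (-x) = phaselessMeasurements A x := by
  ext i; simp [phaselessMeasurements, Matrix.mulVec_neg]

theorem phaseDist_neg {n : ℕ} (x y : EuclideanSpace ℝ (Fin n)) :
    phaseDist x (-y) = phaseDist x y := by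
  rw [phaseDist, phaseDist, sub_neg_eq_add, ← sub_eq_add_neg, min_comm]

/-- By the triangle inequality `2‖y‖ ≤ ‖x + y‖ + ‖x - y‖`. Thus the sign is settled in the basin and
contraction in norm is contraction in `phaseDist`. -/
theorem phaseDist_eq_of_close {n : ℕ} {x y : EuclideanSpace ℝ (Fin n)} (h : ‖x - y‖ ≤ ‖y‖) :
    phaseDist x y = ‖x - y‖ := by
  apply min_eq_left
  have h1 : ‖(2 : ℝ) • y‖ ≤ ‖x + y‖ + ‖x - y‖ := by
    have : (2 : ℝ) • y = (x + y) - (x - y) := by rw [two_smul]; abel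
    rw [this]; exact norm_sub_le _ _
  rw [norm_smul, Real.norm_ofNat] at h1
  linarith

/-- Local linear convergence to a signal in the range of the generator. -/
theorem phasePGD_converges_to {k m n : ℕ} {G : EuclideanSpace ℝ (Fin k) → EuclideanSpace ℝ (Fin n)}
    {A : Matrix (Fin m) (Fin n) ℝ} {xs : EuclideanSpace ℝ (Fin n)} (hxs : xs ∈ Set.range G)
    (hA : ∀ z z', ∃ U : Submodule ℝ (EuclideanSpace ℝ (Fin n)), IsWellConditionedOn A U ∧
      G z ∈ U ∧ G z' ∈ U ∧ xs ∈ U)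
    (hfew : xs ≠ 0 → HasFewSmallMeasurements A xs)
    {η : ℝ} (hη : η ∈ Set.Icc (15 / 16 : ℝ) (17 / 16)) {T : ℕ}
    {x : ℕ → EuclideanSpace ℝ (Fin n)} (hx0 : x 0 ∈ Set.range G)
    (hclose : ‖x 0 - xs‖ ≤ (1 / 4096) ^ 2 * ‖xs‖)
    (hrun : IsPhasePGDRun G A (phaselessMeasurements A xs) η T x) :
    ∀ t < T, phaseDist (x (t + 1)) xs ≤ 1 / 2 * phaseDist (x t) xs := by
  have hrange : ∀ t ≤ T, x t ∈ Set.range G := by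
    intro t ht
    cases t with
    | zero => exact hx0
    | succ t =>
      obtain ⟨_, _, z, hz, _⟩ := hrun t ht
      exact ⟨z, hz.symm⟩
  have hstep : ∀ t < T, ‖x t - xs‖ ≤ (1 / 4096) ^ 2 * ‖xs‖ →
      ‖x (t + 1) - xs‖ ≤ 1 / 2 * ‖x t - xs‖ := by
    intro t ht hcl
    obtain ⟨p, hp, z', hz', hmin⟩ := hrun t ht
    obtain ⟨z, hz⟩ := hrange t ht.le
    obtain ⟨U, hAU, h1, h2, h3⟩ := hA z z'
    obtain ⟨zs, hzs⟩ := hxs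
    refine phasePGD_step hAU h3 (hz ▸ h1) (hz' ▸ h2) hfew hcl hη hp ?_
    have := hmin zs
    rwa [hzs, ← hz'] at this
  have hall : ∀ t ≤ T, ‖x t - xs‖ ≤ (1 / 4096) ^ 2 * ‖xs‖ := by
    intro t
    induction t with
    | zero => exact fun _ => hclose
    | succ t ih =>
      intro ht
      have h1 := ih (by omega)
      have h2 := hstep t ht h1
      linarith [norm_nonneg (x t - xs)]
  intro t ht
  have hxs0 := norm_nonneg xs
  rw [phaseDist_eq_of_close ((hall t ht.le).trans (by linarith)),
    phaseDist_eq_of_close ((hall (t + 1) ht).trans (by linarith))]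
  exact hstep t ht (hall t ht.le)

/-- If `-xs` is the nearer signal, it produces the same measurements and lies in the same subspaces,
so it can replace `xs` as target. It must be in the range of `G` because the projection step is
compared with the target. -/
theorem phasePGD_converges {k m n : ℕ} {G : EuclideanSpace ℝ (Fin k) → EuclideanSpace ℝ (Fin n)}
    {A : Matrix (Fin m) (Fin n) ℝ} {xs : EuclideanSpace ℝ (Fin n)} (hxs : xs ∈ Set.range G)
    (hA : ∀ z z', ∃ U : Submodule ℝ (EuclideanSpace ℝ (Fin n)), IsWellConditionedOn A U ∧
      G z ∈ U ∧ G z' ∈ U ∧ xs ∈ U)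
    (hfew : xs ≠ 0 → HasFewSmallMeasurements A xs)
    {η : ℝ} (hη : η ∈ Set.Icc (15 / 16 : ℝ) (17 / 16)) {T : ℕ}
    {x : ℕ → EuclideanSpace ℝ (Fin n)} (hx0 : x 0 ∈ Set.range G)
    (hclose : phaseDist (x 0) xs ≤ (1 / 4096) ^ 2 * ‖xs‖)
    (hsign : ‖x 0 - xs‖ ≤ ‖x 0 + xs‖ ∨ -xs ∈ Set.range G)
    (hrun : IsPhasePGDRun G A (phaselessMeasurements A xs) η T x) :
    ∀ t < T, phaseDist (x (t + 1)) xs ≤ 1 / 2 * phaseDist (x t) xs := by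
  rcases le_or_gt ‖x 0 - xs‖ ‖x 0 + xs‖ with h | h
  · rw [phaseDist, min_eq_left h] at hclose
    exact phasePGD_converges_to hxs hA hfew hη hx0 hclose hrun
  · have hneg := hsign.resolve_left h.not_ge
    rw [phaseDist, min_eq_right h.le] at hclose
    have := phasePGD_converges_to (xs := -xs) hneg
      (fun z z' => by
        obtain ⟨U, h1, h2, h3, h4⟩ := hA z z'
        exact ⟨U, h1, h2, h3, U.neg_mem h4⟩)
      (fun h0 => (hfew (neg_ne_zero.1 h0)).neg) hη hx0
      (by rwa [sub_neg_eq_add, norm_neg]) (by rwa [phaselessMeasurements_neg])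
    simpa only [phaseDist_neg] using this

/-! ### The union bound and the main theorem -/

/-- The measurements are well conditioned on a fixed subspace with high probability. -/
theorem gaussianMatrix_not_isWellConditionedOn_le {m n : ℕ} (hm : 0 < m)
    (U : Submodule ℝ (EuclideanSpace ℝ (Fin n))) :
    gaussianMatrix m n {A | ¬ IsWellConditionedOn (Matrix.of A) U}
      ≤ ((8 * n + 1) ^ Module.finrank ℝ U * 3 : ℕ) *
        ENNReal.ofReal (Real.exp (-(m / 32768))) := by
  obtain ⟨E, hcard, hEU, hE⟩ := exists_unit_sphere_net U
  set b := ENNReal.ofReal (Real.exp (-((m : ℝ) / 32768)))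
  let S : EuclideanSpace ℝ (Fin n) → Set (Fin m → Fin n → ℝ) := fun e =>
    {A | 1 / 64 ≤ |∑ i, ((Matrix.of A *ᵥ e.ofLp) i) ^ 2 - 1|} ∪
    {A | (m : ℝ) / 128 ≤ ∑ i, max (m * ((Matrix.of A *ᵥ e.ofLp) i) ^ 2 - 32) 0}
  have hS : ∀ e ∈ E, gaussianMatrix m n (S e) ≤ 3 * b := by
    intro e he
    have h1 := gaussianMatrix_norm_sq_concentration hm e (hEU e he).2
    have h2 := gaussianMatrix_truncated_energy hm e (hEU e he).2
    have h3 : ENNReal.ofReal (Real.exp (-((m : ℝ) / 1024))) ≤ b := by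
      apply ENNReal.ofReal_le_ofReal
      apply Real.exp_le_exp.2
      have : (0 : ℝ) ≤ m := Nat.cast_nonneg m
      linarith
    calc _ ≤ _ := measure_union_le _ _
      _ ≤ 2 * b + b := add_le_add h1 (h2.trans h3)
      _ = 3 * b := by ring
  have hsub : {A : Fin m → Fin n → ℝ | ¬ IsWellConditionedOn (Matrix.of A) U} ⊆ ⋃ e ∈ E, S e := by
    intro A hA
    by_contra hnot
    simp only [Set.mem_iUnion, not_exists, S, Set.mem_union, Set.mem_ofPred_eq, not_or,
      not_le] at hnot
    exact hA (isWellConditionedOn_of_net hm hEU hE (fun e he => (hnot e he).1)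
      fun e he => (hnot e he).2)
  calc _ ≤ gaussianMatrix m n (⋃ e ∈ E, S e) := measure_mono hsub
    _ ≤ ∑ e ∈ E, gaussianMatrix m n (S e) := measure_biUnion_finset_le _ _
    _ ≤ ∑ _e ∈ E, 3 * b := Finset.sum_le_sum hS
    _ = (E.card * 3 : ℕ) * b := by
        rw [Finset.sum_const, nsmul_eq_mul]; push_cast; ring
    _ ≤ _ := by gcongr

theorem gaussianMatrix_not_hasFewSmallMeasurements_le {m n : ℕ} (hm : 0 < m)
    {x : EuclideanSpace ℝ (Fin n)} (hx : x ≠ 0) :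
    gaussianMatrix m n {A | ¬ HasFewSmallMeasurements (Matrix.of A) x}
      ≤ ENNReal.ofReal (Real.exp (-(m / 32768))) := by
  have hpos : 0 < ‖x‖ := norm_pos_iff.2 hx
  have h := gaussianMatrix_small_count hm (‖x‖⁻¹ • x) (by simp [norm_smul, hx])
    (a := 1 / 4096) (by norm_num)
  refine (measure_mono fun A hA => ?_).trans (h.trans (ENNReal.ofReal_le_ofReal
    (Real.exp_le_exp.2 ?_)))
  · simp only [Set.mem_ofPred_eq, HasFewSmallMeasurements, not_le] at hA ⊢
    refine hA.le.trans (le_of_eq ?_)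
    congr 3
    ext i
    have : √m * (Matrix.of A *ᵥ (‖x‖⁻¹ • x).ofLp) i
        = (√m * (Matrix.of A *ᵥ x.ofLp) i) / ‖x‖ := by
      simp [Matrix.mulVec_smul]; ring
    rw [this, abs_div, abs_norm, div_le_iff₀ hpos]
  · have : (0 : ℝ) ≤ m := Nat.cast_nonneg m
    linarith

/-- Counts pairs of pieces times net points, with weight 3 for the tail bounds, plus one event for
`xs` itself. The exponent is `35 = 4 + 4 + 25 + 2`, the last 2 absorbing the constants. -/
theorem union_count_le {k d n : ℕ} (hk : 1 ≤ k) (hd : 1 ≤ d) (hn : 2 ≤ n) :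
    (n + 1) ^ ((k + 1) * d) * (n + 1) ^ ((k + 1) * d) * ((8 * n + 1) ^ (2 * k + 3) * 3) + 1
      ≤ n ^ (35 * (k * d)) := by
  have hkd : k ≤ k * d := Nat.le_mul_of_pos_right k hd
  have hkd1 : 1 ≤ k * d := hk.trans hkd
  have h1 : n + 1 ≤ n ^ 2 := by nlinarith
  have h2 : 8 * n + 1 ≤ n ^ 5 := by
    have : 2 ^ 4 ≤ n ^ 4 := Nat.pow_le_pow_left hn 4
    nlinarith [pow_succ n 4]
  have h3 : (k + 1) * d ≤ 2 * (k * d) := by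
    have : d ≤ k * d := Nat.le_mul_of_pos_left d hk
    linarith
  have h4 : (n + 1) ^ ((k + 1) * d) ≤ n ^ (4 * (k * d)) :=
    calc _ ≤ (n ^ 2) ^ (2 * (k * d)) :=
          (Nat.pow_le_pow_left h1 _).trans (Nat.pow_le_pow_right (by positivity) h3)
      _ = _ := by rw [← pow_mul]; congr 1; ring
  have h5 : (8 * n + 1) ^ (2 * k + 3) ≤ n ^ (25 * (k * d)) :=
    calc _ ≤ (n ^ 5) ^ (5 * (k * d)) :=
          (Nat.pow_le_pow_left h2 _).trans (Nat.pow_le_pow_right (by positivity) (by omega))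
      _ = _ := by rw [← pow_mul]; congr 1; ring
  have h6 : 4 ≤ n ^ (2 * (k * d)) :=
    calc 4 = 2 ^ 2 := rfl
      _ ≤ n ^ 2 := Nat.pow_le_pow_left hn 2
      _ ≤ _ := Nat.pow_le_pow_right (by omega) (by omega)
  set X := n ^ (4 * (k * d)) * n ^ (4 * (k * d)) * n ^ (25 * (k * d))
  have hX : 1 ≤ X := Nat.pos_of_ne_zero (by positivity)
  calc _ ≤ n ^ (4 * (k * d)) * n ^ (4 * (k * d)) * (n ^ (25 * (k * d)) * 3) + 1 := by gcongr
    _ = X * 3 + 1 := by ring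
    _ ≤ X * 4 := by omega
    _ ≤ X * n ^ (2 * (k * d)) := Nat.mul_le_mul_left _ h6
    _ = _ := by simp only [X]; rw [← pow_add, ← pow_add, ← pow_add]; congr 1; ring

/-- Half of the rate `1/32768` pays for the union bound; the other half survives. -/
theorem natCast_pow_mul_exp_le {k d n m : ℕ} (hn : 2 ≤ n)
    (hm : 35 * 65536 * (k * d * Real.log n) < m) :
    ((n ^ (35 * (k * d)) : ℕ) : ENNReal) * ENNReal.ofReal (Real.exp (-(m / 32768)))
      ≤ ENNReal.ofReal (Real.exp (-(1 / 65536 * m))) := by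
  have hn' : (0 : ℝ) < n := by positivity
  have h1 : ((n ^ (35 * (k * d)) : ℕ) : ENNReal)
      = ENNReal.ofReal (Real.exp (35 * (k * d) * Real.log n)) := by
    rw [← ENNReal.ofReal_natCast]
    congr 1
    rw [show (35 * (k * d) * Real.log n : ℝ) = ((35 * (k * d) : ℕ) : ℝ) * Real.log n by push_cast; ring,
      Real.exp_nat_mul, Real.exp_log hn']
    push_cast; rfl
  rw [h1, ← ENNReal.ofReal_mul (Real.exp_pos _).le, ← Real.exp_add]
  apply ENNReal.ofReal_le_ofReal
  apply Real.exp_le_exp.2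
  linarith

theorem mainTheorem4 :
    ∃ C δ₀ ρ η₁ η₂ c : ℝ, 0 < C ∧ 0 < δ₀ ∧ δ₀ < 1 ∧ 0 < ρ ∧ ρ < 1 ∧
      0 < η₁ ∧ η₁ < η₂ ∧ 0 < c ∧
      ∀ (k d n m : ℕ) (G : EuclideanSpace ℝ (Fin k) → EuclideanSpace ℝ (Fin n))
        (xstar : EuclideanSpace ℝ (Fin n)) (η : ℝ),
        2 ≤ n → IsReLUGenerator d G → xstar ∈ Set.range G →
        C * (k * d * Real.log n) < m → η ∈ Set.Icc η₁ η₂ →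
        gaussianMatrix m n
          {A | ¬ ∀ (T : ℕ) (x : ℕ → EuclideanSpace ℝ (Fin n)),
            x 0 ∈ Set.range G →
            phaseDist (x 0) xstar ≤ δ₀ * ‖xstar‖ →
            (‖x 0 - xstar‖ ≤ ‖x 0 + xstar‖ ∨ -xstar ∈ Set.range G) →
            IsPhasePGDRun G (Matrix.of A) (phaselessMeasurements (Matrix.of A) xstar) η T x →
            ∀ t < T, phaseDist (x (t + 1)) xstar ≤ ρ * phaseDist (x t) xstar}
          ≤ ENNReal.ofReal (Real.exp (-(c * m))) := by
  classical
  refine ⟨35 * 65536, (1 / 4096) ^ 2, 1 / 2, 15 / 16, 17 / 16, 1 / 65536, by norm_num, by norm_num,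
    by norm_num, by norm_num, by norm_num, by norm_num, by norm_num, by norm_num, ?_⟩
  intro k d n m G xs η hn hG hxs hm hη
  obtain ⟨hd, F, hF, hGF⟩ := exists_affine_pieces_generator hG
  -- For `k = 0` the range is a single point, so every projection returns `xs` and the bad event is
  -- empty. The count above needs `k ≥ 1`.
  rcases Nat.eq_zero_or_pos k with rfl | hk
  · refine (le_of_eq ?_).trans zero_le
    convert measure_empty (μ := gaussianMatrix m n)
    rw [Set.eq_empty_iff_forall_notMem]
    intro A hA
    refine hA fun T x _ _ _ hrun t ht => ?_
    obtain ⟨_, _, z, hz, _⟩ := hrun t ht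
    obtain ⟨zs, rfl⟩ := hxs
    have h0 : phaseDist (x (t + 1)) (G zs) = 0 := by
      rw [hz, Subsingleton.elim z zs, phaseDist, sub_self, norm_zero]
      exact min_eq_left (norm_nonneg _)
    rw [h0]
    exact mul_nonneg (by norm_num) (le_min (norm_nonneg _) (norm_nonneg _))
  have hm0 : 0 < m := by
    have : (0 : ℝ) ≤ 35 * 65536 * (k * d * Real.log n) := by positivity
    exact_mod_cast this.trans_lt hm
  set b := ENNReal.ofReal (Real.exp (-((m : ℝ) / 32768)))
  let bad : Set (Fin m → Fin n → ℝ) := ⋃ p ∈ F ×ˢ F,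
    {A | ¬ IsWellConditionedOn (Matrix.of A) (pieceSpan p.1 p.2 xs)}
  let few : Set (Fin m → Fin n → ℝ) := {A | xs ≠ 0 ∧ ¬ HasFewSmallMeasurements (Matrix.of A) xs}
  have hfew : gaussianMatrix m n few ≤ b := by
    by_cases h0 : xs = 0
    · simp [few, h0]
    · exact (measure_mono fun A hA => hA.2).trans
        (gaussianMatrix_not_hasFewSmallMeasurements_le hm0 h0)
  have hbad : gaussianMatrix m n bad ≤ ((n + 1) ^ ((k + 1) * d) * (n + 1) ^ ((k + 1) * d) *
      ((8 * n + 1) ^ (2 * k + 3) * 3) : ℕ) * b := by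
    calc gaussianMatrix m n bad
        ≤ ∑ p ∈ F ×ˢ F, gaussianMatrix m n
            {A | ¬ IsWellConditionedOn (Matrix.of A) (pieceSpan p.1 p.2 xs)} :=
          measure_biUnion_finset_le _ _
      _ ≤ ∑ _p ∈ F ×ˢ F, ((8 * n + 1) ^ (2 * k + 3) * 3 : ℕ) * b := by
          refine Finset.sum_le_sum fun p _ =>
            (gaussianMatrix_not_isWellConditionedOn_le hm0 _).trans ?_
          gcongr
          · omega
          · exact finrank_pieceSpan_le _ _ _
      _ = (F.card * F.card * ((8 * n + 1) ^ (2 * k + 3) * 3) : ℕ) * b := by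
          rw [Finset.sum_const, Finset.card_product, nsmul_eq_mul, ← mul_assoc, ← Nat.cast_mul]
      _ ≤ _ := by gcongr
  calc _ ≤ gaussianMatrix m n (bad ∪ few) := by
        -- Outside `bad ∪ few` the argument is deterministic and uniform over all runs;
        -- measurability of the failure event is not needed.
        refine measure_mono fun A hA => ?_
        by_contra hnot
        simp only [Set.mem_union, not_or, bad, few, Set.mem_iUnion, not_exists, Set.mem_ofPred_eq,
          not_not, not_and] at hnot
        refine hA fun T x hx0 hclose hsign hrun =>
          phasePGD_converges hxs (fun z z' => ?_) hnot.2 hη hx0 hclose hsign hrun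
        obtain ⟨φ, hφ, hz⟩ := hGF z
        obtain ⟨ψ, hψ, hz'⟩ := hGF z'
        refine ⟨pieceSpan φ ψ xs, hnot.1 (φ, ψ) (Finset.mem_product.2 ⟨hφ, hψ⟩), ?_, ?_, ?_⟩
        · rw [hz]; exact (mem_pieceSpan φ ψ xs z).1
        · rw [hz']; exact (mem_pieceSpan φ ψ xs z').2.1
        · exact (mem_pieceSpan φ ψ xs z).2.2
    _ ≤ gaussianMatrix m n bad + gaussianMatrix m n few := measure_union_le _ _
    _ ≤ ((n + 1) ^ ((k + 1) * d) * (n + 1) ^ ((k + 1) * d) *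
      ((8 * n + 1) ^ (2 * k + 3) * 3) : ℕ) * b + b := add_le_add hbad hfew
    _ = ((n + 1) ^ ((k + 1) * d) * (n + 1) ^ ((k + 1) * d) *
      ((8 * n + 1) ^ (2 * k + 3) * 3) + 1 : ℕ) * b := by
        rw [Nat.cast_add_one, add_mul _ (1 : ENNReal), one_mul]
    _ ≤ (n ^ (35 * (k * d)) : ℕ) * b := by
        gcongr
        exact union_count_le hk hd hn
    _ ≤ _ := natCast_pow_mul_exp_le hn hm
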